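/- **Conventions.** Let $\mathbb{F}$ be an infinite field (for instance $\mathbb{Q}$, $\mathbb{R}$ or $\mathbb{C}$). An *algebraic circuit with projection gates* over $\mathbb{F}$ is a finite directed acyclic graph, with a designated output node, whose leaves are labelled by variables or constants from $\mathbb{F}$ and whose internal nodes are sum gates, product gates (both of arbitrary fan-in), or projection gates. A projection gate is labelled by a variable $w$ and a constant $b\in\{0,1\}$, has one child, and computes $f|_{w=b}$ when its child computes the polynomial $f$. The *size* of a circuit is its number of wires (edges). Besides its input variables, a circuit may use auxiliary variables that are eliminated by projection gates. A circuit $C(\mathbf z,\mathbf y)$ *encodes* a polynomial map $\mathcal G=(g_1(\mathbf z),\dots,g_n(\mathbf z))$ if there are assignments $\mathbf a_1,\dots,\mathbf a_n$ of constants from $\mathbb{F}$ to $\mathbf y$ such that $C(\mathbf z,\mathbf a_i)=g_i(\mathbf z)$ for every $i\in\{1,\dots,n\}$. **Theorem (Annihilators of explicit maps).** There are absolute constants $c, m_0\in\mathbb{N}$ such that the following holds for every infinite field $\mathbb{F}$ and all natural numbers $m\ge m_0$, $n\ge 2m$, $d\ge 1$, $s\ge 1$. Let $\mathcal G=(g_1(\mathbf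 z),\dots,g_n(\mathbf z)):\mathbb{F}^m\to\mathbb{F}^n$ be a polynomial map given by polynomials $g_i\in\mathbb{F}[z_1,\dots,z_m]$ of total degree at most $d$, and suppose that $\mathcal G$ is encoded by a circuit with projection gates $C_{\mathcal G}(\mathbf z,\mathbf y)$ of size at most $s$. Then there is a nonzero polynomial $A\in\mathbb{F}[x_1,\dots,x_n]$ of individual degree at most $3md$ that annihilates $\mathcal G$, that is, $A(g_1(\mathbf z),\dots,g_n(\mathbf z))\equiv 0$, and a circuit with projection gates $C'(\mathbf x)$ of size at most $(m\cdot d\cdot s)^c$ that computes $A$. -/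

import Mathlib

open scoped Classical in
/-- `projection w b p` sets the variable `w` to the constant `b ∈ {0, 1}` in `p`. -/
noncomputable def projection {F V : Type*} [Field F] (w : V) (b : Bool)
    (p : MvPolynomial V F) : MvPolynomial V F :=
  MvPolynomial.aeval
    (Function.update MvPolynomial.X w (MvPolynomial.C (if b then (1 : F) else 0))) p

/-- Labels of the nodes of an algebraic circuit with projection gates over the field `F`, with
variables from `V` and nodes from `N`, together with the incoming wires of the node.  A list of
children may repeat a node (parallel wires), and fan-in is unbounded.  A sum or product without
children behaves as a leaf labelled with the constant `0` or `1`. -/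
inductive Gate (F V N : Type*) where
  | const (a : F) : Gate F V N
  | var (v : V) : Gate F V N
  | sum (l : List N) : Gate F V N
  | prod (l : List N) : Gate F V N
  | proj (w : V) (b : Bool) (u : N) : Gate F V N

namespace Gate

variable {F V N : Type*}

/-- The list of the tails of the wires that enter the node. -/
def children : Gate F V N → List N
  | const _ => []
  | var _ => []
  | sum l => l
  | prod l => l
  | proj _ _ u => [u]

/-- The polynomial computed at a node, given the polynomials computed at its children. -/
noncomputable def eval [Field F] (val : N → MvPolynomial V F) : Gate F V N → MvPolynomial V F
  | const a => MvPolynomial.C a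
  | var v => MvPolynomial.X v
  | sum l => (l.map val).sum
  | prod l => (l.map val).prod
  | proj w b u => projection w b (val u)

theorem eval_congr [Field F] {val val' : N → MvPolynomial V F} (g : Gate F V N)
    (h : ∀ u ∈ g.children, val u = val' u) : g.eval val = g.eval val' := by
  cases g with
  | const a => rfl
  | var v => rfl
  | sum l => exact congrArg List.sum (List.map_congr_left h)
  | prod l => exact congrArg List.prod (List.map_congr_left h)
  | proj w b u => exact congrArg (projection w b) (h u (List.mem_singleton.2 rfl))

end Gate

/-- An algebraic circuit with projection gates over the field `F`, with variables from `V`: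
a finite directed acyclic graph with labelled nodes and a designated output node.  Acyclicity is
well-foundedness of the relation "there is a wire from `u` to `v`". -/
structure ProjCircuit (F V : Type*) where
  Node : Type
  [fintypeNode : Fintype Node]
  gate : Node → Gate F V Node
  acyclic : WellFounded fun u v : Node => u ∈ (gate v).children
  output : Node

namespace ProjCircuit

attribute [instance] ProjCircuit.fintypeNode

variable {F V : Type*}

/-- The size of a circuit is the number of its wires. -/
def size (C : ProjCircuit F V) : ℕ := ∑ v : C.Node, (C.gate v).children.length

open scoped Classical in
/-- The polynomial computed at a node, by recursion along the wires (see `value_eq`). -/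
noncomputable def value [Field F] (C : ProjCircuit F V) : C.Node → MvPolynomial V F :=
  C.acyclic.fix fun v ih =>
    (C.gate v).eval fun u => if h : u ∈ (C.gate v).children then ih u h else 0

theorem value_eq [Field F] (C : ProjCircuit F V) (v : C.Node) :
    C.value v = (C.gate v).eval C.value := by
  rw [value, WellFounded.fix_eq]
  refine Gate.eval_congr _ fun u hu => ?_
  rw [dif_pos hu]

/-- The polynomial computed by the circuit. -/
noncomputable def poly [Field F] (C : ProjCircuit F V) : MvPolynomial V F := C.value C.output

/-- `C(z, y)` encodes the polynomial map `g = (g_1(z), …, g_n(z))`: there are assignments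
`a_1, …, a_n` of field constants to `y` such that `C(z, a_i) = g_i(z)` for every `i`.
Here `y` consists of all the variables of the circuit other than `z`, including those that occur
only as labels of projection gates or in their scope. -/
def Encodes [Field F] {m n k : ℕ} (C : ProjCircuit F (Fin m ⊕ Fin k))
    (g : Fin n → MvPolynomial (Fin m) F) : Prop :=
  ∃ a : Fin n → Fin k → F, ∀ i : Fin n,
    MvPolynomial.aeval
      (Sum.elim MvPolynomial.X fun j => (MvPolynomial.C (a i j) : MvPolynomial (Fin m) F))
      C.poly = g i

/-- The circuit computes `A(x)`.  Apart from `x_1, …, x_n` it may use `k` auxiliary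
variables (those that its projection gates eliminate), which do not occur in the output. -/
def Computes [Field F] {n k : ℕ} (C : ProjCircuit F (Fin n ⊕ Fin k))
    (A : MvPolynomial (Fin n) F) : Prop :=
  C.poly = MvPolynomial.rename Sum.inl A

end ProjCircuit

/-- `A` annihilates the polynomial map `g`: `A(g_1(z), …, g_n(z))` is the zero polynomial. -/
def Annihilates {F : Type*} [Field F] {m n : ℕ} (A : MvPolynomial (Fin n) F)
    (g : Fin n → MvPolynomial (Fin m) F) : Prop :=
  MvPolynomial.aeval g A = 0

/-! Let E = 2 ^ β be the largest power of two with E ≤ 3md + 1, and keep only 2m of the g_i. The E ^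
(2m) monomials in them with exponents below E have degree at most 2md(E - 1) in m variables, and the
space of such polynomials has smaller dimension (`choose_lt`); so these monomials are linearly
dependent. Let r be the first one that depends on its predecessors. The annihilator is the
determinant of the matrix whose row r lists the formal monomials x^c, whose earlier rows come from a
Gram matrix of the values of the g^c on a grid, and whose later rows are those of the identity. The
coefficient of x^r is a leading minor of the Gram matrix, nonzero for suitable weights of the grid
points (`exists_det_gram_ne_zero`). After substituting x = g, the linear relation becomes a kernel
vector (`det_prefixMatrix_eq_zero`).

The matrix is exponentially large, but a few bits address its entries. Projection gates make
summation over a bit cheap: f|_{b=0} + f|_{b=1} uses one shared node for f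
(`ProjCircuit.Cost.sum_bit`). Hence exponential sums, products of exponentially large matrices and,
by repeated squaring, their exponentially high powers take polynomially many wires. The
division-free clow formula of Mahajan and Vinay (`det_eq_sum_clow`) writes a determinant through
such a power. The entries need the g_i at grid points; these come from substitution into the
encoding circuit (`ProjCircuit.Cost.subst`), where switches record which variables have been
projected. -/

/-! ### Determinants through sequences of closed walks -/

/-- The transition matrix of closed walks with decreasing heads: a state consists of the head of
the current walk and of the current vertex. -/
def clowMatrix {R : Type*} [CommRing R] {K : ℕ} (N : Matrix (Fin K) (Fin K) R) :
    Matrix (Fin K × Fin K) (Fin K × Fin K) R :=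
  Matrix.of fun p q => (if q.1 = p.1 ∧ q.2 < p.1 then N p.2 q.2 else 0) -
    if q.1 < p.1 ∧ q.2 = q.1 then N p.2 p.1 else 0

/-- The weights of the last step of a sequence of closed walks. -/
def clowEnd {R : Type*} [CommRing R] {K : ℕ} (N : Matrix (Fin K) (Fin K) R)
    (p : Fin K × Fin K) : R := -N p.2 p.1

namespace Clow

variable {R : Type*} [CommRing R] {K : ℕ} (N : Matrix (Fin K) (Fin K) R)

theorem sum_lt {M : Type*} [AddCommMonoid M] {k : ℕ} (hk : k ≤ K) (f : Fin K → M) :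
    (∑ c : Fin K, if c.val < k then f c else 0) = ∑ i : Fin k, f (Fin.castLE hk i) := by
  rw [← Finset.sum_filter]
  symm
  refine Finset.sum_bij (fun i _ => Fin.castLE hk i) (fun i _ => by simp) (fun i _ j _ h => by
    simpa using h) (fun c hc => ?_) fun i _ => rfl
  exact ⟨⟨c, by simpa using hc⟩, by simp, by ext; simp⟩

/-- Generating function of the weights of the sequences of closed walks from a given state. -/
noncomputable def gen (p : Fin K × Fin K) : PowerSeries R :=
  PowerSeries.mk fun l => if l = 0 then 0 else
    ((clowMatrix N ^ (l - 1)).mulVec (clowEnd N)) p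

theorem gen_eq_sum (p : Fin K × Fin K) :
    gen N p = PowerSeries.X * (PowerSeries.C (clowEnd N p) +
      ∑ q, PowerSeries.C (clowMatrix N p q) * gen N q) := by
  ext l
  cases l with
  | zero => simp [gen]
  | succ l =>
    rw [PowerSeries.coeff_succ_X_mul]
    cases l with
    | zero => simp [gen]
    | succ l =>
      simp only [gen, PowerSeries.coeff_mk, map_add, map_sum, PowerSeries.coeff_C_mul,
        PowerSeries.coeff_C, Nat.add_eq_zero_iff, one_ne_zero, and_false, if_false, zero_add,
        Nat.add_sub_cancel]
      rw [pow_succ', ← Matrix.mulVec_mulVec]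
      rfl

/-- A walk with head k at vertex c either moves to a vertex below k or closes, with a sign. After
closing, the sequence stops (the summand 1) or a new walk starts at a smaller head. -/
theorem gen_eq {k : ℕ} (hk : k < K) (c : Fin K) :
    gen N (⟨k, hk⟩, c) = PowerSeries.X *
      ((∑ i : Fin k, PowerSeries.C (N c (Fin.castLE hk.le i)) *
          gen N (⟨k, hk⟩, Fin.castLE hk.le i)) -
        PowerSeries.C (N c ⟨k, hk⟩) *
          (1 + ∑ i : Fin k, gen N (Fin.castLE hk.le i, Fin.castLE hk.le i))) := by
  rw [gen_eq_sum, Fintype.sum_prod_type]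
  congr 1
  have h1 : ∀ x y : Fin K, PowerSeries.C (clowMatrix N (⟨k, hk⟩, c) (x, y)) * gen N (x, y) =
      (if x = ⟨k, hk⟩ then if y.val < k then PowerSeries.C (N c y) * gen N (x, y) else 0 else 0) -
      if y = x then if x.val < k then PowerSeries.C (N c ⟨k, hk⟩) * gen N (x, y) else 0 else 0 := by
    intro x y
    simp only [clowMatrix, Matrix.of_apply, Fin.lt_def, map_sub, sub_mul, ite_and]
    split_ifs <;> simp
  simp only [h1, Finset.sum_sub_distrib, Finset.sum_ite_eq', Finset.mem_univ, if_true]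
  have h2 : ∀ x : Fin K, (∑ y : Fin K, if x = ⟨k, hk⟩ then if y.val < k then
      PowerSeries.C (N c y) * gen N (x, y) else 0 else 0) = if x = ⟨k, hk⟩ then
        ∑ y : Fin K, if y.val < k then PowerSeries.C (N c y) * gen N (x, y) else 0 else 0 :=
    fun x => by split_ifs <;> simp
  simp only [h2, Finset.sum_ite_eq', Finset.mem_univ, if_true]
  rw [sum_lt hk.le, sum_lt hk.le fun x => PowerSeries.C (N c ⟨k, hk⟩) * gen N (x, x),
    ← Finset.mul_sum, clowEnd, map_neg]
  ring

/-- The matrix `1 - X N` for a leading principal submatrix of `N`. -/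
noncomputable def lead (k : ℕ) (hk : k ≤ K) : Matrix (Fin k) (Fin k) (PowerSeries R) :=
  1 - (PowerSeries.X : PowerSeries R) •
    (N.submatrix (Fin.castLE hk) (Fin.castLE hk)).map PowerSeries.C

theorem constantCoeff_det_lead (k : ℕ) (hk : k ≤ K) :
    PowerSeries.constantCoeff (lead N k hk).det = 1 := by
  rw [RingHom.map_det]
  convert Matrix.det_one (n := Fin k) (R := R)
  ext i j
  by_cases h : i = j <;> simp [lead, h, Matrix.one_apply]

/-- Induction on k. With D the previous determinant and g the series for head k, the recurrence says
that 1 - XN maps the vector (-g_i, D) to a multiple g_k + D of the last unit vector. Applying the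
adjugate, whose last diagonal entry is D, gives det · D = D · (g_k + D); D has constant term 1 and
cancels. -/
theorem one_add_sum_gen [IsDomain R] (k : ℕ) (hk : k ≤ K) :
    1 + ∑ i : Fin k, gen N (Fin.castLE hk i, Fin.castLE hk i) = (lead N k hk).det := by
  induction k with
  | zero => simp
  | succ k ih =>
    have hk' : k < K := hk
    specialize ih hk'.le
    set D := (lead N k hk'.le).det with hD
    have hD0 : D ≠ 0 := fun h => by
      have := constantCoeff_det_lead N k hk'.le
      rw [← hD, h, map_zero] at this
      exact zero_ne_one this
    let g (c : Fin K) := gen N (⟨k, hk'⟩, c)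
    have hg : ∀ c, g c = PowerSeries.X * ((∑ i : Fin k, PowerSeries.C (N c (Fin.castLE hk'.le i)) *
        g (Fin.castLE hk'.le i)) - PowerSeries.C (N c ⟨k, hk'⟩) * D) := fun c => by
      rw [← ih]; exact gen_eq N hk' c
    let v : Fin (k + 1) → PowerSeries R := Fin.snoc (α := fun _ => PowerSeries R)
      (fun i => -g (Fin.castLE hk'.le i)) D
    have hlast : Fin.castLE hk (Fin.last k) = ⟨k, hk'⟩ := rfl
    have hcast : ∀ i : Fin k, Fin.castLE hk i.castSucc = Fin.castLE hk'.le i := fun i => rfl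
    have hXN : ∀ c : Fin (k + 1),
        ((PowerSeries.X : PowerSeries R) •
          (N.submatrix (Fin.castLE hk) (Fin.castLE hk)).map PowerSeries.C).mulVec v c =
          -g (Fin.castLE hk c) := by
      intro c
      rw [hg, Matrix.smul_mulVec, Pi.smul_apply, smul_eq_mul, Matrix.mulVec, dotProduct,
        Fin.sum_univ_castSucc]
      simp only [v, Fin.snoc_castSucc, Fin.snoc_last, Matrix.map_apply, Matrix.submatrix_apply,
        hlast, hcast, mul_neg, Finset.sum_neg_distrib]
      ring
    have hQ : (lead N (k + 1) hk).mulVec v = Pi.single (Fin.last k) (g ⟨k, hk'⟩ + D) := by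
      funext c
      rw [lead, Matrix.sub_mulVec, Pi.sub_apply, hXN, Matrix.one_mulVec]
      cases c using Fin.lastCases with
      | last => simp [v, hlast, add_comm]
      | cast i => simp [v, hcast, Fin.castSucc_ne_last]
    have hadj : (lead N (k + 1) hk).adjugate (Fin.last k) (Fin.last k) = D := by
      rw [Matrix.adjugate_fin_succ_eq_det_submatrix, hD]
      rw [← two_mul, pow_mul]
      simp only [even_two, Even.neg_pow, one_pow, one_mul, Fin.succAbove_last]
      congr 1
      ext i j
      simp [lead, Matrix.one_apply]
    have h1 := congrFun (congrArg ((lead N (k + 1) hk).adjugate).mulVec hQ) (Fin.last k)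
    rw [Matrix.mulVec_mulVec, Matrix.adjugate_mul, Matrix.smul_mulVec, Matrix.one_mulVec,
      Matrix.mulVec_single] at h1
    simp only [v, Pi.smul_apply, Fin.snoc_last, smul_eq_mul, Matrix.col_apply, hadj,
      MulOpposite.smul_eq_mul_unop, MulOpposite.unop_op] at h1
    rw [Fin.sum_univ_castSucc, ← add_assoc]
    simp only [hcast, hlast, ih]
    exact (mul_right_cancel₀ hD0 (h1.trans (by ring))).symm

end Clow

/-- Both sides are the coefficient of X ^ K in det(1 - XN). It counts sequences with K steps in all:
K - 1 transitions and the closing step. -/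
theorem det_eq_sum_clow {R : Type*} [CommRing R] [IsDomain R] {K : ℕ} (hK : 0 < K)
    (N : Matrix (Fin K) (Fin K) R) :
    (-1) ^ K * N.det = ∑ k, ((clowMatrix N ^ (K - 1)).mulVec (clowEnd N)) (k, k) := by
  have h1 := congrArg (PowerSeries.coeff K) (Clow.one_add_sum_gen N K le_rfl)
  have h2 : (Clow.lead N K le_rfl).det = (N.charpolyRev : PowerSeries R) := by
    rw [Matrix.charpolyRev, ← Polynomial.coeToPowerSeries.ringHom_apply, RingHom.map_det]
    congr 1
    ext i j : 1
    by_cases h : i = j <;> simp [Clow.lead, h, mul_comm PowerSeries.X]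
  rw [h2, Polynomial.coeff_coe, ← Matrix.reverse_charpoly] at h1
  have h3 : N.charpoly.reverse.coeff K = N.charpoly.coeff 0 := by
    have : N.charpoly.natDegree = K := by simp [Matrix.charpoly_natDegree_eq_dim]
    rw [Polynomial.coeff_reverse, this, Polynomial.revAt_le le_rfl, Nat.sub_self]
  rw [h3, map_add, map_sum, PowerSeries.coeff_one, if_neg hK.ne', zero_add] at h1
  rw [Matrix.det_eq_sign_charpoly_coeff, ← h1, Fintype.card_fin, ← mul_assoc, ← mul_pow]
  simp [Clow.gen, hK.ne']

/-! ### Monomials with exponents given by bits -/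

theorem Nat.ofBits_injective {κ : ℕ} :
    Function.Injective (Nat.ofBits : (Fin κ → Bool) → ℕ) := fun x y h => funext fun i => by
  rw [← Nat.testBit_ofBits_lt x i i.2, h, Nat.testBit_ofBits_lt]

theorem pow_ofBits {M : Type*} [CommMonoid M] {κ : ℕ} (y : M) (x : Fin κ → Bool) :
    y ^ Nat.ofBits x = ∏ i, if x i then y ^ 2 ^ i.val else 1 := by
  induction κ generalizing y with
  | zero => simp
  | succ κ ih =>
    rw [Nat.ofBits_succ, pow_add, pow_mul, ih, Fin.prod_univ_succ, mul_comm]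
    congr 1
    · cases x 0 <;> simp
    · refine Finset.prod_congr rfl fun i _ => ?_
      rw [← pow_mul, Fin.val_succ, pow_succ', Function.comp_apply]

/-- The monomial in the `y i` whose exponents have the binary digits `x`. -/
def powBits {M : Type*} [CommMonoid M] {N β : ℕ} (y : Fin N → M) (x : Fin (N * β) → Bool) : M :=
  ∏ i, y i ^ Nat.ofBits fun b => x (finProdFinEquiv (i, b))

theorem powBits_eq_prod {M : Type*} [CommMonoid M] {N β : ℕ} (y : Fin N → M)
    (x : Fin (N * β) → Bool) :
    powBits y x = ∏ q : Fin N × Fin β, if x (finProdFinEquiv q) then y q.1 ^ 2 ^ q.2.val else 1 := by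
  rw [Fintype.prod_prod_type]
  exact Finset.prod_congr rfl fun i _ => pow_ofBits _ _

theorem map_powBits {M M' G : Type*} [CommMonoid M] [CommMonoid M'] [FunLike G M M']
    [MonoidHomClass G M M'] (f : G) {N β : ℕ} (y : Fin N → M) (x : Fin (N * β) → Bool) :
    f (powBits y x) = powBits (fun i => f (y i)) x := by
  simp [powBits]

/-! ### Weighted Gram matrices and the first linear relation -/

section Gram

variable {F ι U : Type*} [Field F] [DecidableEq ι] [Fintype U]

/-- The Gram matrix of the columns of `M` with respect to the weights `a ^ idx u`. -/
def gram {R : Type*} [CommRing R] (idx : U → ℕ) (M : U → ι → R) (a : R) : Matrix ι ι R :=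
  Matrix.of fun c c' => ∑ u, a ^ idx u * (M u c * M u c')

/-- The matrix with row `r` equal to `x`, previous rows those of `G`, and later rows those of the
identity matrix. -/
def prefixMatrix {R : Type*} [CommRing R] (idx : ι → ℕ) (r : ι) (G : Matrix ι ι R) (x : ι → R) :
    Matrix ι ι R :=
  Matrix.of fun c c' => if c = r then x c' else if idx c < idx r then G c c' else
    if c = c' then 1 else 0

theorem prefixMatrix_map {R R' : Type*} [CommRing R] [CommRing R'] (f : R →+* R') (idx : ι → ℕ)
    (r : ι) (G : Matrix ι ι R) (x : ι → R) :
    (prefixMatrix idx r G x).map f = prefixMatrix idx r (G.map f) fun c => f (x c) := by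
  ext c c'
  simp only [prefixMatrix, Matrix.map_apply, Matrix.of_apply]
  split_ifs <;> simp

theorem prefixMatrix_updateRow {R : Type*} [CommRing R] (idx : ι → ℕ) (r : ι) (G : Matrix ι ι R)
    (x y : ι → R) :
    (prefixMatrix idx r G x).updateRow r y = prefixMatrix idx r G y := by
  ext c c'
  by_cases h : c = r
  · subst h; simp [prefixMatrix]
  · simp [prefixMatrix, Matrix.updateRow_ne, h]

variable [Fintype ι]

theorem Matrix.det_updateRow_eq_sum {R : Type*} [CommRing R] (M : Matrix ι ι R) (r : ι)
    (x : ι → R) : (M.updateRow r x).det = ∑ j, x j * M.adjugate j r := by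
  rw [Matrix.det_eq_sum_mul_adjugate_row _ r]
  simp [Matrix.adjugate_apply]

/-- Expansion along row r. The cofactors do not involve x, so the same coefficients serve for the
formal monomials and for their values under the polynomial map. -/
theorem det_prefixMatrix {R : Type*} [CommRing R] [Algebra F R] (idx : ι → ℕ) (r : ι)
    (G : Matrix ι ι F) (x : ι → R) :
    (prefixMatrix idx r (G.map (algebraMap F R)) x).det =
      ∑ j, x j * algebraMap F R ((prefixMatrix idx r G 0).adjugate j r) := by
  rw [← prefixMatrix_updateRow idx r _ 0 x, Matrix.det_updateRow_eq_sum]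
  refine Finset.sum_congr rfl fun j _ => ?_
  have := prefixMatrix_map (algebraMap F R) idx r G 0
  simp only [Pi.zero_apply, map_zero] at this
  rw [show (0 : ι → R) = fun _ => 0 from rfl, ← this]
  change _ * ((algebraMap F R).mapMatrix _).adjugate j r = _
  rw [← RingHom.map_adjugate]
  rfl

open Polynomial in
/-- The leading coefficients of a kernel vector of the Gram matrix with generic weights form a
kernel vector of the matrix itself. -/
theorem exists_det_gram_ne_zero [Infinite F] (idx : ι → ℕ) (idxU : U → ℕ)
    (hU : Function.Injective idxU) (r : ι) (M : U → ι → F)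
    (hM : ∀ v : ι → F, (∀ c, ¬ idx c < idx r → v c = 0) → (∀ u, ∑ c, M u c * v c = 0) → v = 0) :
    ∃ a : F, (prefixMatrix idx r (gram idxU M a) (Pi.single r 1)).det ≠ 0 := by
  -- An unweighted Gram matrix may be singular because of isotropic vectors; an indeterminate weight
  -- excludes this, and an infinite field then has a good value for it.
  let G : Matrix ι ι F[X] := gram idxU (fun u c => C (M u c)) X
  have hdet : (prefixMatrix idx r G (Pi.single r 1)).det ≠ 0 := by
    intro h0
    obtain ⟨v, hv0, hv⟩ := Matrix.exists_mulVec_eq_zero_iff.2 h0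
    have hrow := fun c => congrFun hv c
    simp only [Matrix.mulVec, dotProduct, prefixMatrix, Matrix.of_apply, Pi.zero_apply] at hrow
    have hvr : ∀ c, ¬ idx c < idx r → v c = 0 := by
      intro c hc
      have := hrow c
      by_cases h : c = r
      · subst h; simpa [Pi.single_apply] using this
      · simpa [h, hc] using this
    obtain ⟨j₁, hj₁⟩ : ∃ j, v j ≠ 0 := by
      by_contra! h
      exact hv0 (funext h)
    obtain ⟨j₀, -, hj₀⟩ := Finset.exists_max_image Finset.univ (fun j => (v j).natDegree) ⟨j₁, by simp⟩
    set δ := (v j₀).natDegree with hδ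
    let top : ι → F := fun j => (v j).coeff δ
    have htop : top ≠ 0 := by
      intro h
      have h1 : v j₀ = 0 := leadingCoeff_eq_zero.1 (congrFun h j₀)
      have h2 : δ = 0 := by rw [hδ, h1, natDegree_zero]
      have h3 : (v j₁).natDegree = 0 := Nat.le_zero.1 ((hj₀ j₁ (by simp)).trans h2.le)
      have h4 := congrFun h j₁
      simp only [top, h2, Pi.zero_apply] at h4
      rw [eq_C_of_natDegree_eq_zero h3, h4, C_0] at hj₁
      exact hj₁ rfl
    let w : U → F[X] := fun u => ∑ c, C (M u c) * v c
    have hwδ : ∀ u, (w u).natDegree ≤ δ := fun u =>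
      natDegree_sum_le_of_forall_le _ _ fun c _ => (natDegree_C_mul_le _ _).trans (hj₀ c (by simp))
    let ω : U → F := fun u => ∑ c, M u c * top c
    have hwω : ∀ u, (w u).coeff δ = ω u := fun u => by simp [w, ω, top]
    obtain ⟨u₁, hu₁⟩ : ∃ u, ω u ≠ 0 := by
      by_contra! h
      exact htop (hM top (fun c hc => by simp [top, hvr c hc]) h)
    classical
    obtain ⟨u₀, hu₀, hmax⟩ := Finset.exists_max_image (Finset.univ.filter fun u => ω u ≠ 0) idxU
      ⟨u₁, by simpa using hu₁⟩
    -- The Gram form pairs the kernel vector `v` with its own vector of top coefficients.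
    have hsum : ∑ u, X ^ idxU u * (C (ω u) * w u) = 0 := by
      have h1 : ∀ c, C (top c) * ∑ u, X ^ idxU u * (C (M u c) * w u) = 0 := by
        intro c
        by_cases hc : idx c < idx r
        · have := hrow c
          simp only [if_neg (show c ≠ r by rintro rfl; exact lt_irrefl _ hc), if_pos hc, G, gram,
            Matrix.of_apply, Finset.sum_mul] at this
          rw [Finset.sum_comm] at this
          convert mul_zero _
          rw [← this]
          refine Finset.sum_congr rfl fun u _ => ?_
          rw [Finset.mul_sum, Finset.mul_sum]
          exact Finset.sum_congr rfl fun c' _ => by ring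
        · simp [top, hvr c hc]
      have h2 := Finset.sum_congr (rfl : (Finset.univ : Finset ι) = _) fun c _ => h1 c
      simp only [Finset.mul_sum] at h2
      rw [Finset.sum_comm, Finset.sum_const_zero] at h2
      rw [← h2]
      refine Finset.sum_congr rfl fun u _ => ?_
      rw [map_sum, Finset.sum_mul, Finset.mul_sum]
      refine Finset.sum_congr rfl fun c _ => ?_
      rw [C_mul]; ring
    -- As `u₀` has the largest index with `ω u₀ ≠ 0`, only it contributes in this degree, and the
    -- coefficient is `ω u₀ ^ 2`.
    have hco := congrArg (fun p => coeff p (idxU u₀ + δ)) hsum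
    simp only [finsetSum_coeff, coeff_X_pow_mul', coeff_C_mul, coeff_zero] at hco
    rw [Finset.sum_eq_single u₀] at hco
    · rw [if_pos (Nat.le_add_right _ _), Nat.add_sub_cancel_left, hwω] at hco
      exact (Finset.mem_filter.1 hu₀).2 (mul_self_eq_zero.1 hco)
    · intro u _ hu
      by_cases hω : ω u = 0
      · simp [hω]
      · have hlt : idxU u < idxU u₀ :=
          lt_of_le_of_ne (hmax u (by simpa using hω)) fun h => hu (hU h)
        rw [coeff_eq_zero_of_natDegree_lt (lt_of_le_of_lt (hwδ u) (by omega)), mul_zero, ite_self]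
    · simp
  by_contra! h
  refine hdet (Polynomial.funext fun a => ?_)
  rw [eval_zero, ← h a, ← coe_evalRingHom, RingHom.map_det]
  congr 1
  change (prefixMatrix idx r G (Pi.single r 1)).map (evalRingHom a) = _
  rw [prefixMatrix_map]
  congr 1
  · ext c c'
    simp [G, gram, eval_finsetSum]
  · funext c
    by_cases h : c = r
    · subst h; simp
    · simp [h]

/-- The first index at which a linearly dependent family becomes dependent, and weights such that
the Gram matrix of the members before it is regular. -/
theorem exists_prefix_relation [Infinite F] {E : Type*} [AddCommGroup E] [Module F E]
    (idx : ι → ℕ)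
    (idxU : U → ℕ) (hU : Function.Injective idxU) (h : ι → E) (ev : U → E →ₗ[F] F)
    (hit : ∀ v : ι → F, (∀ u, ev u (∑ c, v c • h c) = 0) → ∑ c, v c • h c = 0)
    (hdep : ∃ v : ι → F, v ≠ 0 ∧ ∑ c, v c • h c = 0) :
    ∃ (r : ι) (a : F),
      (prefixMatrix idx r (gram idxU (fun u c => ev u (h c)) a) (Pi.single r 1)).det ≠ 0 ∧
      ∃ v : ι → F, v ≠ 0 ∧ ∑ c, v c • h c = 0 ∧ ∀ c, idx r < idx c → v c = 0 := by
  classical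
  have hex : ∃ k, ∃ v : ι → F, v ≠ 0 ∧ ∑ c, v c • h c = 0 ∧ ∀ c, k ≤ idx c → v c = 0 := by
    obtain ⟨v, h1, h2⟩ := hdep
    refine ⟨Finset.univ.sup idx + 1, v, h1, h2, fun c hc => ?_⟩
    have := Finset.le_sup (f := idx) (Finset.mem_univ c)
    omega
  obtain ⟨v, hv0, hv, hvk⟩ := Nat.find_spec hex
  set k := Nat.find hex
  have hk0 : k ≠ 0 := fun h0 => hv0 (funext fun c => hvk c (by omega))
  have hmin : ∀ w : ι → F, (∀ c, k - 1 ≤ idx c → w c = 0) → ∑ c, w c • h c = 0 → w = 0 := by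
    intro w hw hws
    by_contra hw0
    exact Nat.find_min hex (m := k - 1) (by omega) ⟨w, hw0, hws, hw⟩
  -- If no index had this value, the bound `k` could be lowered, against minimality.
  obtain ⟨r, hr⟩ : ∃ r, idx r = k - 1 := by
    by_contra! hne
    refine hv0 (hmin v (fun c hc => hvk c ?_) hv)
    have := hne c
    omega
  obtain ⟨a, ha⟩ := exists_det_gram_ne_zero idx idxU hU r
    (fun u c => ev u (h c)) fun w hw hws => by
      refine hmin w (fun c hc => hw c (by omega)) (hit w fun u => ?_)
      rw [map_sum, ← hws u]
      exact Finset.sum_congr rfl fun c _ => by rw [map_smul, smul_eq_mul, mul_comm]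
  exact ⟨r, a, ha, v, hv0, hv, fun c hc => hvk c (by omega)⟩

/-- The determinant vanishes when its distinguished row satisfies the same relation. -/
theorem det_prefixMatrix_eq_zero {R : Type*} [CommRing R] [IsDomain R] [Algebra F R]
    (idx : ι → ℕ) (idxU : U → ℕ) (h : ι → R) (ev : U → R →ₗ[F] F)
    (r : ι) (a : F) (v : ι → F) (hv0 : v ≠ 0) (hv : ∑ c, v c • h c = 0)
    (hvr : ∀ c, idx r < idx c → v c = 0) (hidx : Function.Injective idx) :
    (prefixMatrix idx r ((gram idxU (fun u c => ev u (h c)) a).map (algebraMap F R)) h).det = 0 := by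
  refine Matrix.exists_mulVec_eq_zero_iff.1 ⟨fun c => algebraMap F R (v c), ?_, ?_⟩
  · intro h0
    exact hv0 (funext fun c => (map_eq_zero_iff _ (algebraMap F R).injective).1 (congrFun h0 c))
  · funext c
    simp only [Matrix.mulVec, dotProduct, prefixMatrix, Matrix.of_apply, Pi.zero_apply,
      Matrix.map_apply]
    by_cases hc : c = r
    · simp only [hc, if_true]
      rw [← hv]
      exact Finset.sum_congr rfl fun c _ => by rw [Algebra.smul_def, mul_comm]
    · by_cases hlt : idx c < idx r
      · simp only [if_neg hc, if_pos hlt, ← map_mul, ← map_sum]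
        convert map_zero (algebraMap F R)
        simp only [gram, Matrix.of_apply, Finset.sum_mul]
        rw [Finset.sum_comm]
        refine Finset.sum_eq_zero fun u _ => ?_
        have : ev u (∑ c, v c • h c) = 0 := by rw [hv, map_zero]
        rw [map_sum] at this
        -- Each Gram row is a combination of rows of evaluations, which all kill a true relation.
        calc _ = a ^ idxU u * ev u (h c) * ∑ c', ev u (v c' • h c') := by
              rw [Finset.mul_sum]
              exact Finset.sum_congr rfl fun c' _ => by rw [map_smul, smul_eq_mul]; ring
          _ = 0 := by rw [this, mul_zero]
      · have : idx r < idx c := by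
          have := hidx.ne hc
          omega
        simp [hc, hlt, hvr c this]

end Gram

/-! ### Dimension count and a hitting set -/

open MvPolynomial

/-- More polynomials than monomials are linearly dependent. -/
theorem exists_relation_of_totalDegree_le {F ι : Type*} [Field F] [Fintype ι] {m Δ : ℕ}
    (h : ι → MvPolynomial (Fin m) F) (hΔ : ∀ c, (h c).totalDegree ≤ Δ)
    (hcard : (m + Δ).choose Δ < Fintype.card ι) :
    ∃ v : ι → F, v ≠ 0 ∧ ∑ c, v c • h c = 0 := by
  classical
  -- The extra index `none` is a slack exponent that homogenizes degree at most Δ to exactly Δ.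
  let S := Finset.finsuppAntidiag (Finset.univ : Finset (Option (Fin m))) Δ
  have hS : S.card = (m + Δ).choose Δ := by
    rw [Finset.card_finsuppAntidiag_nat_eq_choose]
    congr 1
    simp
  let Λ : (ι → F) →ₗ[F] (S → F) :=
    LinearMap.pi fun e => (MvPolynomial.lcoeff F e.1.some) ∘ₗ
      (Fintype.linearCombination F h)
  have hker : LinearMap.ker Λ ≠ ⊥ := by
    apply LinearMap.ker_ne_bot_of_finrank_lt
    simpa [hS] using hcard
  obtain ⟨v, hv, hv0⟩ := (Submodule.ne_bot_iff _).1 hker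
  refine ⟨v, hv0, ?_⟩
  ext e
  rw [coeff_zero]
  by_cases he : e.degree ≤ Δ
  · let e' : Option (Fin m) →₀ ℕ := Finsupp.optionElim (Δ - e.degree) e
    have he' : e' ∈ S := by
      rw [Finset.mem_finsuppAntidiag]
      refine ⟨?_, by simp⟩
      rw [Fintype.sum_option]
      simp only [e', Finsupp.optionElim_apply_none, Finsupp.optionElim_apply_some]
      rw [Finsupp.degree_eq_sum] at he ⊢
      omega
    have := congrFun (LinearMap.mem_ker.1 hv) ⟨e', he'⟩
    simpa [Λ, e', Fintype.linearCombination_apply, coeff_sum] using this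
  · refine coeff_eq_zero_of_totalDegree_lt (lt_of_le_of_lt ?_ (not_le.1 he))
    refine (totalDegree_finsetSum _ _).trans (Finset.sup_le fun c _ => ?_)
    exact (totalDegree_smul_le _ _).trans (hΔ c)

theorem four_pow_lt {m : ℕ} (hm : 3 ≤ m) : 4 ^ m < 3 ^ m * m.factorial := by
  induction m, hm using Nat.le_induction with
  | base => decide
  | succ m hm ih =>
    rw [pow_succ, pow_succ, Nat.factorial_succ]
    have h : 4 ≤ 3 * (m + 1) := by omega
    calc 4 ^ m * 4 < 3 ^ m * m.factorial * 4 := by omega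
      _ ≤ 3 ^ m * m.factorial * (3 * (m + 1)) := Nat.mul_le_mul_left _ h
      _ = _ := by ring

/-- The binomial coefficient is at most (2mdE)^m / m!. Since 3md < 2E, the base 2mdE is at most
(4/3)E², and (4/3)^m < m! by `four_pow_lt`. -/
theorem choose_lt {m d E : ℕ} (hm : 3 ≤ m) (hd : 1 ≤ d) (hE : 3 * m * d + 1 < 2 * E) :
    (m + 2 * m * d * (E - 1)).choose (2 * m * d * (E - 1)) < (E ^ 2) ^ m := by
  set Δ := 2 * m * d * (E - 1) with hΔ
  have hmd : m ≤ m * d := Nat.le_mul_of_pos_right _ hd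
  have h1 : m + Δ ≤ 2 * m * d * E := by
    obtain ⟨e, rfl⟩ : ∃ e, E = e + 1 := ⟨E - 1, by omega⟩
    rw [hΔ, Nat.add_sub_cancel]
    nlinarith
  have h2 : 3 * (2 * m * d * E) ≤ 4 * E ^ 2 := by nlinarith
  have hc : (m + Δ).choose Δ = (m + Δ).choose m := by
    rw [← Nat.choose_symm_add]
  rw [hc]
  have hE0 : 0 < E := by omega
  have h3 : m.factorial * (m + Δ).choose m ≤ (2 * m * d * E) ^ m := by
    rw [← Nat.descFactorial_eq_factorial_mul_choose]
    exact (Nat.descFactorial_le_pow _ _).trans (Nat.pow_le_pow_left h1 m)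
  have h4 : 3 ^ m * (2 * m * d * E) ^ m ≤ 4 ^ m * (E ^ 2) ^ m := by
    rw [← mul_pow, ← mul_pow]; exact Nat.pow_le_pow_left h2 m
  have h5 : 4 ^ m * (E ^ 2) ^ m < 3 ^ m * m.factorial * (E ^ 2) ^ m :=
    Nat.mul_lt_mul_of_pos_right (four_pow_lt hm) (by positivity)
  refine lt_of_mul_lt_mul_left (a := 3 ^ m * m.factorial) ?_ (Nat.zero_le _)
  calc 3 ^ m * m.factorial * (m + Δ).choose m
      = 3 ^ m * (m.factorial * (m + Δ).choose m) := by ring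
    _ ≤ 3 ^ m * (2 * m * d * E) ^ m := Nat.mul_le_mul_left _ h3
    _ < _ := lt_of_le_of_lt h4 h5

/-- Subset sums of the constants `γ`. -/
def gridPoint {F : Type*} [Field F] {m L : ℕ} (γ : Fin L → F) (u : Fin m × Fin L → Bool)
    (j : Fin m) : F := ∑ i, if u (j, i) then γ i else 0

/-- Selecting one constant per coordinate already yields the whole grid γ^m, which suffices for
degree below L. Admitting all subset sums lets every bit string name a point, so no validity test is
needed. -/
theorem eq_zero_of_eval_gridPoint {F : Type*} [Field F] {m L : ℕ} (γ : Fin L → F)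
    (hγ : Function.Injective γ) (p : MvPolynomial (Fin m) F) (hp : p.totalDegree < L)
    (h : ∀ u : Fin m × Fin L → Bool, eval (gridPoint γ u) p = 0) : p = 0 := by
  classical
  refine eq_zero_of_eval_zero_at_prod_finset p (fun _ => Finset.univ.image γ) (fun i => ?_)
    fun x hx => ?_
  · rw [Finset.card_image_of_injective _ hγ, Finset.card_univ, Fintype.card_fin]
    exact (degreeOf_le_totalDegree p i).trans_lt hp
  · have : ∀ j, ∃ i, γ i = x j := fun j => by simpa using hx j
    choose f hf using this
    rw [← h fun q => decide (q.2 = f q.1)]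
    congr 2
    funext j
    simp [gridPoint, hf]

/-! ### Renaming and extending circuits -/

namespace Gate

variable {F V N N' : Type*}

/-- Rename the nodes that a gate refers to. -/
def mapNode (f : N → N') : Gate F V N → Gate F V N'
  | const a => const a
  | var v => var v
  | sum l => sum (l.map f)
  | prod l => prod (l.map f)
  | proj w b u => proj w b (f u)

theorem children_mapNode (f : N → N') (g : Gate F V N) :
    (g.mapNode f).children = g.children.map f := by
  cases g <;> rfl

theorem eval_mapNode [Field F] (f : N → N') (g : Gate F V N) (val : N' → MvPolynomial V F) :
    (g.mapNode f).eval val = g.eval (val ∘ f) := by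
  cases g <;> simp [mapNode, eval]

/-- Rename the variables of a gate. -/
def mapVar {V' : Type*} (e : V → V') : Gate F V N → Gate F V' N
  | const a => const a
  | var v => var (e v)
  | sum l => sum l
  | prod l => prod l
  | proj w b u => proj (e w) b u

theorem children_mapVar {V' : Type*} (e : V → V') (g : Gate F V N) :
    (g.mapVar e).children = g.children := by
  cases g <;> rfl

end Gate

theorem aeval_projection {F V R : Type*} [Field F] [CommSemiring R] [Algebra F R]
    [DecidableEq V] (s : V → R) (w : V) (b : Bool) (p : MvPolynomial V F) :
    aeval s (projection w b p) = aeval (Function.update s w (if b then 1 else 0)) p := by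
  unfold projection
  rw [← AlgHom.comp_apply]
  congr 1
  ext v
  by_cases h : v = w
  · subst h
    cases b <;> simp
  · rw [AlgHom.comp_apply, aeval_X, aeval_X, Function.update_of_ne h]
    exact (congrArg (aeval s) (@Function.update_of_ne _ _ (_) _ _ h _ _)).trans (aeval_X _ _)

theorem rename_projection {F V V' : Type*} [Field F] (e : V → V') (he : Function.Injective e)
    (w : V) (b : Bool) (p : MvPolynomial V F) :
    rename e (projection w b p) = projection (e w) b (rename e p) := by
  classical
  unfold projection
  rw [aeval_rename, ← AlgHom.comp_apply]
  congr 1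
  ext v : 1
  by_cases h : v = w
  · subst h
    cases b <;> simp
  · rw [AlgHom.comp_apply, aeval_X, aeval_X, Function.comp_apply,
      Function.update_of_ne (he.ne h), Function.update_of_ne h, rename_X]

namespace ProjCircuit

variable {F V : Type*}

/-- Add a node, which becomes the output, to a circuit. -/
abbrev extend (C : ProjCircuit F V) (g : Gate F V C.Node) : ProjCircuit F V where
  Node := Option C.Node
  gate o := o.elim (g.mapNode some) fun v => (C.gate v).mapNode some
  acyclic := by
    have hs : ∀ v : C.Node, Acc (fun u v : Option C.Node =>
        u ∈ (v.elim (g.mapNode some) fun v => (C.gate v).mapNode some).children) (some v) := by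
      intro v
      induction v using C.acyclic.induction with
      | _ v ih =>
        refine ⟨_, fun u hu => ?_⟩
        simp only [Option.elim, Gate.children_mapNode, List.mem_map] at hu
        obtain ⟨x, hx, rfl⟩ := hu
        exact ih x hx
    refine ⟨fun o => ?_⟩
    cases o with
    | some v => exact hs v
    | none =>
      refine ⟨_, fun u hu => ?_⟩
      simp only [Option.elim, Gate.children_mapNode, List.mem_map] at hu
      obtain ⟨x, _, rfl⟩ := hu
      exact hs x
  output := none

theorem size_extend (C : ProjCircuit F V) (g : Gate F V C.Node) :
    (C.extend g).size = C.size + g.children.length := by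
  change ∑ v : Option C.Node, _ = _
  rw [Fintype.sum_option, add_comm]
  simp [extend, size, Gate.children_mapNode]

theorem value_extend_some [Field F] (C : ProjCircuit F V) (g : Gate F V C.Node) (v : C.Node) :
    (C.extend g).value (some v) = C.value v := by
  induction v using C.acyclic.induction with
  | _ v ih =>
    rw [value_eq, value_eq]
    change ((C.gate v).mapNode some).eval _ = _
    rw [Gate.eval_mapNode]
    exact Gate.eval_congr _ fun u hu => ih u hu

theorem poly_extend [Field F] (C : ProjCircuit F V) (g : Gate F V C.Node) :
    (C.extend g).poly = g.eval C.value := by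
  rw [poly, value_eq]
  change (g.mapNode some).eval _ = _
  rw [Gate.eval_mapNode]
  exact Gate.eval_congr _ fun u _ => C.value_extend_some g u

/-- Rename the variables of a circuit. -/
abbrev mapVar {V' : Type*} (C : ProjCircuit F V) (e : V → V') : ProjCircuit F V' where
  Node := C.Node
  gate v := (C.gate v).mapVar e
  acyclic := by
    simp only [Gate.children_mapVar]
    exact C.acyclic
  output := C.output

theorem size_mapVar {V' : Type*} (C : ProjCircuit F V) (e : V → V') :
    (C.mapVar e).size = C.size :=
  Finset.sum_congr rfl fun v _ => congrArg List.length (Gate.children_mapVar e (C.gate v))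

theorem value_mapVar [Field F] {V' : Type*} (C : ProjCircuit F V) (e : V → V')
    (he : Function.Injective e) (v : C.Node) :
    (C.mapVar e).value v = rename e (C.value v) := by
  induction v using C.acyclic.induction with
  | _ v ih =>
    rw [value_eq, C.value_eq]
    change ((C.gate v).mapVar e).eval _ = _
    have hl : ∀ l : List C.Node, (∀ u ∈ l, (C.mapVar e).value u = rename e (C.value u)) →
        l.map (C.mapVar e).value = (l.map C.value).map (rename e) := fun l h => by
      rw [List.map_map]; exact List.map_congr_left h
    cases hg : C.gate v with
    | const a => simp [Gate.mapVar, Gate.eval]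
    | var x => simp [Gate.mapVar, Gate.eval]
    | sum l =>
      rw [Gate.mapVar, Gate.eval, Gate.eval, map_list_sum]
      exact congrArg List.sum (hl l fun u hu => ih u (by rw [hg]; exact hu))
    | prod l =>
      rw [Gate.mapVar, Gate.eval, Gate.eval, map_list_prod]
      exact congrArg List.prod (hl l fun u hu => ih u (by rw [hg]; exact hu))
    | proj w b u =>
      rw [Gate.mapVar, Gate.eval, Gate.eval, rename_projection e he]
      exact congrArg _ (ih u (by rw [hg]; exact List.mem_singleton.2 rfl))

/-! ### Functions of bits computed by circuits -/

variable {Y B : Type*} [Field F]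

/-- Substitute bits for the auxiliary variables. -/
noncomputable def bitEval (a : B → Bool) : MvPolynomial (Y ⊕ B) F →ₐ[F] MvPolynomial Y F :=
  aeval (Sum.elim X fun b => if a b then 1 else 0)

/-- The functions of the auxiliary bits that are computed at the nodes of a circuit. -/
def vals (C : ProjCircuit F (Y ⊕ B)) : Set ((B → Bool) → MvPolynomial Y F) :=
  Set.range fun v a => bitEval a (C.value v)

/-- `Cost S n T`: any circuit that computes the functions in `S` can be extended by `n` wires to
one that also computes those in `T`. -/
def Cost (S : Set ((B → Bool) → MvPolynomial Y F)) (n : ℕ)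
    (T : Set ((B → Bool) → MvPolynomial Y F)) : Prop :=
  ∀ C : ProjCircuit F (Y ⊕ B), S ⊆ C.vals →
    ∃ C' : ProjCircuit F (Y ⊕ B), C.vals ⊆ C'.vals ∧ T ⊆ C'.vals ∧ C'.size ≤ C.size + n

namespace Cost

variable {S S' T T' U : Set ((B → Bool) → MvPolynomial Y F)} {n n' k : ℕ}
  {φ ψ : (B → Bool) → MvPolynomial Y F}

theorem mono (h : Cost S n T) (hS : S ⊆ S') (hn : n ≤ n') (hT : T' ⊆ T) : Cost S' n' T' := by
  intro C hC
  obtain ⟨C', h1, h2, h3⟩ := h C (hS.trans hC)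
  exact ⟨C', h1, hT.trans h2, by omega⟩

theorem mono_left (h : Cost S n T) (hS : S ⊆ S') : Cost S' n T := h.mono hS le_rfl subset_rfl

theorem mono_cost (h : Cost S n T) (hn : n ≤ n') : Cost S n' T := h.mono subset_rfl hn subset_rfl

theorem of_subset (h : T ⊆ S) : Cost S 0 T := fun C hC => ⟨C, subset_rfl, h.trans hC, le_rfl⟩

theorem of_mem (h : φ ∈ S) : Cost S 0 {φ} := of_subset (Set.singleton_subset_iff.2 h)

theorem bind (h : Cost S n T) (h' : Cost (S ∪ T) k U) : Cost S (n + k) (T ∪ U) := by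
  intro C hC
  obtain ⟨C₁, h1, h2, h3⟩ := h C hC
  obtain ⟨C₂, h4, h5, h6⟩ := h' C₁ (Set.union_subset (hC.trans h1) h2)
  exact ⟨C₂, h1.trans h4, Set.union_subset (h2.trans h4) h5, by omega⟩

theorem trans (h : Cost S n T) (h' : Cost (S ∪ T) k U) : Cost S (n + k) U :=
  (h.bind h').mono subset_rfl le_rfl Set.subset_union_right

theorem union (h : Cost S n T) (h' : Cost S k U) : Cost S (n + k) (T ∪ U) :=
  h.bind (h'.mono_left Set.subset_union_left)

theorem image {I : Type*} (s : Finset I) (f : I → (B → Bool) → MvPolynomial Y F) (c : I → ℕ)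
    (h : ∀ i ∈ s, Cost S (c i) {f i}) : Cost S (∑ i ∈ s, c i) (f '' s) := by
  classical
  induction s using Finset.induction_on with
  | empty => simpa using of_subset (Set.empty_subset S)
  | insert i s hi ih =>
    rw [Finset.sum_insert hi, Finset.coe_insert, Set.image_insert_eq, Set.insert_eq]
    exact (h i (by simp)).union (ih fun j hj => h j (by simp [hj]))

theorem range {I : Type*} [Fintype I] (f : I → (B → Bool) → MvPolynomial Y F)
    (h : ∀ i, Cost S n {f i}) : Cost S (Fintype.card I * n) (Set.range f) := by
  simpa using image Finset.univ f (fun _ => n) fun i _ => h i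

/-- The function computed by a gate. -/
theorem gate (l : List ((B → Bool) → MvPolynomial Y F)) (hl : ∀ ψ ∈ l, ψ ∈ S)
    (hg : ∀ (N : Type) (val : N → MvPolynomial (Y ⊕ B) F) (L : List N),
      (L.map fun v a => bitEval a (val v)) = l →
      ∃ g : Gate F (Y ⊕ B) N, g.children.length ≤ n ∧ (fun a => bitEval a (g.eval val)) = φ) :
    Cost S n {φ} := by
  intro C hC
  obtain ⟨L, hL⟩ : ∃ L : List C.Node, (L.map fun v a => bitEval a (C.value v)) = l := by
    have : l ∈ Set.range (List.map fun v a => bitEval a (C.value v)) := by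
      rw [Set.range_list_map]
      exact fun ψ hψ => hC (hl ψ hψ)
    exact this
  obtain ⟨g, hgn, hgφ⟩ := hg C.Node C.value L hL
  refine ⟨C.extend g, ?_, ?_, ?_⟩
  · rintro _ ⟨v, rfl⟩
    exact ⟨some v, by simp only [value_extend_some]⟩
  · rw [Set.singleton_subset_iff, ← hgφ]
    exact ⟨none, funext fun a => congrArg (bitEval a) (C.poly_extend g)⟩
  · rw [size_extend]; omega

theorem const (c : F) : Cost S 0 {fun _ => C c} :=
  gate [] (by simp) fun N val L _ => ⟨.const c, le_rfl, by simp [Gate.eval, bitEval]⟩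

theorem zero : Cost S 0 {fun _ => 0} := by simpa using const (S := S) 0

theorem one : Cost S 0 {fun _ => 1} := by simpa using const (S := S) 1

theorem var (x : Y) : Cost S 0 {fun _ => X x} :=
  gate [] (by simp) fun N val L _ => ⟨.var (.inl x), le_rfl, by simp [Gate.eval, bitEval]⟩

theorem bit (b : B) : Cost S 0 {fun a => if a b then 1 else 0} :=
  gate [] (by simp) fun N val L _ => ⟨.var (.inr b), le_rfl, by simp [Gate.eval, bitEval]⟩

theorem list_sum (l : List ((B → Bool) → MvPolynomial Y F)) (hl : ∀ ψ ∈ l, ψ ∈ S) :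
    Cost S l.length {l.sum} := by
  refine gate l hl fun N val L hL => ⟨.sum L, by simp [← hL, Gate.children], ?_⟩
  subst hL
  funext a
  rw [Gate.eval, map_list_sum]
  clear hl
  induction L with
  | nil => simp
  | cons v L ih => simp_all

theorem list_prod (l : List ((B → Bool) → MvPolynomial Y F)) (hl : ∀ ψ ∈ l, ψ ∈ S) :
    Cost S l.length {l.prod} := by
  refine gate l hl fun N val L hL => ⟨.prod L, by simp [← hL, Gate.children], ?_⟩
  subst hL
  funext a
  rw [Gate.eval, map_list_prod]
  clear hl
  induction L with
  | nil => simp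
  | cons v L ih => simp_all

theorem add (h : Cost S n {φ}) (h' : Cost S k {ψ}) : Cost S (n + k + 2) {fun a => φ a + ψ a} := by
  refine (h.union h').trans ?_
  have := list_sum (S := S ∪ ({φ} ∪ {ψ})) [φ, ψ] (by simp)
  simpa [Pi.add_def] using this

theorem mul (h : Cost S n {φ}) (h' : Cost S k {ψ}) : Cost S (n + k + 2) {fun a => φ a * ψ a} := by
  refine (h.union h').trans ?_
  have := list_prod (S := S ∪ ({φ} ∪ {ψ})) [φ, ψ] (by simp)
  simpa [Pi.mul_def] using this

theorem neg (h : Cost S n {φ}) : Cost S (n + 2) {fun a => -φ a} := by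
  simpa using (const (-1)).mul h

theorem sub (h : Cost S n {φ}) (h' : Cost S k {ψ}) : Cost S (n + k + 4) {fun a => φ a - ψ a} := by
  simpa [sub_eq_add_neg, add_assoc] using h.add h'.neg

/-- On Boolean assignments a projection gate is the writing of a constant into a bit. -/
theorem proj [DecidableEq B] (h : Cost S n {φ}) (b : B) (c : Bool) :
    Cost S (n + 1) {fun a => φ (Function.update a b c)} := by
  refine h.trans (gate [φ] (by simp) fun N val L hL => ?_)
  obtain ⟨v, rfl, hv⟩ : ∃ v, L = [v] ∧ (fun a => bitEval a (val v)) = φ := by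
    cases L with
    | nil => simp at hL
    | cons v L => cases L <;> simp_all
  refine ⟨.proj (.inr b) c v, le_rfl, ?_⟩
  classical
  funext a
  rw [← hv]
  simp only [Gate.eval, bitEval]
  rw [aeval_projection]
  congr 1
  congr 1
  funext x
  rcases x with x | x
  · simp
  · by_cases hx : x = b
    · subst hx; simp
    · simp [Function.update_of_ne hx]

end Cost

end ProjCircuit

/-! ### Boolean tests, registers and sums over bits -/

namespace ProjCircuit.Cost

variable {F Y B : Type*} [Field F] {S : Set ((B → Bool) → MvPolynomial Y F)} {n k : ℕ}
  {φ ψ : (B → Bool) → MvPolynomial Y F}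

theorem sum {I : Type*} [Fintype I] {f : I → (B → Bool) → MvPolynomial Y F}
    (h : ∀ i, Cost S n {f i}) : Cost S (Fintype.card I * (n + 1)) {fun a => ∑ i, f i a} := by
  have := (range f h).trans (list_sum (S := S ∪ Set.range f) (Finset.univ.toList.map f) (by simp))
  rw [Finset.sum_map_toList] at this
  simp only [List.length_map, Finset.length_toList, Finset.card_univ] at this
  refine this.mono subset_rfl (by ring_nf; rfl) (by simp [Finset.sum_fn])

theorem prod {I : Type*} [Fintype I] {f : I → (B → Bool) → MvPolynomial Y F}
    (h : ∀ i, Cost S n {f i}) : Cost S (Fintype.card I * (n + 1)) {fun a => ∏ i, f i a} := by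
  have := (range f h).trans (list_prod (S := S ∪ Set.range f) (Finset.univ.toList.map f) (by simp))
  rw [Finset.prod_map_toList] at this
  simp only [List.length_map, Finset.length_toList, Finset.card_univ] at this
  refine this.mono subset_rfl (by ring_nf; rfl) (by simp [Finset.prod_fn])

theorem ite {β : (B → Bool) → Bool} {m : ℕ} (h : Cost S m {fun a => if β a then 1 else 0})
    (hφ : Cost S n {φ}) (hψ : Cost S k {ψ}) :
    Cost S (m + n + k + 12) {fun a => if β a then φ a else ψ a} := by
  refine h.trans (T := {fun a => if β a then 1 else 0}) (k := n + k + 12) ?_ |>.mono_cost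
    (by omega)
  have hb : Cost (S ∪ {fun a => if β a then (1 : MvPolynomial Y F) else 0}) 0
      {fun a => if β a then 1 else 0} := of_mem (by simp)
  have := ((hb.mul (hφ.mono_left Set.subset_union_left)).add
    ((one.sub hb).mul (hψ.mono_left Set.subset_union_left)))
  refine this.mono subset_rfl (by omega) ?_
  rw [Set.singleton_subset_iff, Set.mem_singleton_iff]
  funext a
  split_ifs <;> simp

theorem const_bool (b : Bool) :
    Cost S 0 {fun _ => if b then (1 : MvPolynomial Y F) else 0} := by
  cases b
  · simpa using zero
  · simpa using one

theorem and {β γ : (B → Bool) → Prop} [∀ a, Decidable (β a)] [∀ a, Decidable (γ a)]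
    (h : Cost S n {fun a => if β a then 1 else 0}) (h' : Cost S k {fun a => if γ a then 1 else 0}) :
    Cost S (n + k + 2) {fun a => if β a ∧ γ a then 1 else 0} := by
  refine (h.mul h').mono subset_rfl le_rfl ?_
  rw [Set.singleton_subset_iff, Set.mem_singleton_iff]
  funext a
  by_cases h1 : β a <;> by_cases h2 : γ a <;> simp [h1, h2]

theorem all {I : Type*} [Fintype I] {β : I → (B → Bool) → Prop} [∀ i a, Decidable (β i a)]
    [∀ a, Decidable (∀ i, β i a)]
    (h : ∀ i, Cost S n {fun a => if β i a then 1 else 0}) :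
    Cost S (Fintype.card I * (n + 1)) {fun a => if ∀ i, β i a then 1 else 0} := by
  refine (prod h).mono subset_rfl le_rfl ?_
  rw [Set.singleton_subset_iff, Set.mem_singleton_iff]
  funext a
  rw [Finset.prod_ite_zero]
  simp

theorem beq {β γ : (B → Bool) → Bool} (h : Cost S 0 {fun a => if β a then 1 else 0})
    (h' : Cost S 0 {fun a => if γ a then 1 else 0}) :
    Cost S 16 {fun a => if β a = γ a then 1 else 0} := by
  refine (h.ite h' (one.sub h')).mono subset_rfl le_rfl ?_
  rw [Set.singleton_subset_iff, Set.mem_singleton_iff]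
  funext a
  cases β a <;> cases γ a <;> simp

theorem eq {I : Type*} [Fintype I] {β γ : I → (B → Bool) → Bool}
    [∀ a, Decidable ((fun i => β i a) = fun i => γ i a)]
    (h : ∀ i, Cost S 0 {fun a => if β i a then 1 else 0})
    (h' : ∀ i, Cost S 0 {fun a => if γ i a then 1 else 0}) :
    Cost S (Fintype.card I * 17)
      {fun a => if (fun i => β i a) = (fun i => γ i a) then 1 else 0} := by
  classical
  refine (all fun i => (h i).beq (h' i)).mono subset_rfl le_rfl ?_
  simp [funext_iff]

/-- Digit 0 is the least significant: the higher digits decide, and if they agree, digit 0 does.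
These cases are disjoint, so their indicators add up. -/
theorem lt {κ : ℕ} {β γ : Fin κ → (B → Bool) → Bool}
    (h : ∀ i, Cost S 0 {fun a => if β i a then 1 else 0})
    (h' : ∀ i, Cost S 0 {fun a => if γ i a then 1 else 0}) :
    Cost S (κ * (κ * 17 + 20))
      {fun a => if Nat.ofBits (fun i => β i a) < Nat.ofBits (fun i => γ i a) then 1 else 0} := by
  induction κ with
  | zero => simpa using zero
  | succ κ ih =>
    have h1 := ih (fun i => h i.succ) (fun i => h' i.succ)
    have h2 := eq (fun i => h (Fin.succ i)) (fun i => h' (Fin.succ i))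
    have h3 := h1.add (h2.mul ((one.sub (h 0)).mul (h' 0)))
    refine h3.mono subset_rfl ?_ ?_
    · simp only [Fintype.card_fin]; nlinarith
    rw [Set.singleton_subset_iff, Set.mem_singleton_iff]
    funext a
    rw [Nat.ofBits_succ, Nat.ofBits_succ]
    have he : ((fun i => β (Fin.succ i) a) = fun i => γ (Fin.succ i) a) ↔
        Nat.ofBits (fun i => β (Fin.succ i) a) = Nat.ofBits (fun i => γ (Fin.succ i) a) := by
      refine ⟨fun h => by rw [h], fun h => funext fun i => ?_⟩
      rw [← Nat.testBit_ofBits_lt (fun i => β (Fin.succ i) a) i i.2, h, Nat.testBit_ofBits_lt]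
    simp only [he, Function.comp_def]
    rcases lt_trichotomy (Nat.ofBits fun i => β (Fin.succ i) a)
      (Nat.ofBits fun i => γ (Fin.succ i) a) with hlt | heq | hgt
    · rw [if_pos hlt, if_neg hlt.ne, if_pos]
      · simp
      · have := Bool.toNat_lt (β 0 a); omega
    · simp only [heq]
      cases β 0 a <;> cases γ 0 a <;> simp
    · rw [if_neg hgt.not_gt, if_neg hgt.ne', if_neg]
      · simp
      · have := Bool.toNat_lt (γ 0 a); omega

variable [DecidableEq B]

/-- Projections write only constants; a computed bit is written by selecting between the two
projections of one shared node. -/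
theorem assign {β : (B → Bool) → Bool} {m : ℕ} (hφ : Cost S n {φ})
    (h : Cost S m {fun a => if β a then 1 else 0}) (b : B) :
    Cost S (m + n + 14) {fun a => φ (Function.update a b (β a))} := by
  have h1 : Cost (S ∪ {φ}) 0 {φ} := of_mem (by simp)
  have := hφ.trans ((h.mono_left Set.subset_union_left).ite (h1.proj b true) (h1.proj b false))
  refine this.mono subset_rfl (by omega) ?_
  rw [Set.singleton_subset_iff, Set.mem_singleton_iff]
  funext a
  cases β a <;> simp

theorem clear (hφ : Cost S n {φ}) (s : Finset B) :
    Cost S (n + s.card) {fun a => φ fun b => if b ∈ s then false else a b} := by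
  induction s using Finset.induction_on with
  | empty => simpa using hφ
  | insert b s hb ih =>
    rw [Finset.card_insert_of_notMem hb, ← add_assoc]
    refine (ih.proj b false).mono subset_rfl le_rfl ?_
    rw [Set.singleton_subset_iff, Set.mem_singleton_iff]
    funext a
    congr 1
    funext x
    by_cases hx : x = b
    · subst hx; simp
    · simp [hx]

/-- The bits of `s` are overwritten one at a time; as all sources lie outside `s`, no assignment
disturbs another. -/
theorem comp (s : Finset B) (ρ : B → B) (hρ : ∀ b ∉ s, ρ b = b) (hρs : ∀ b ∈ s, ρ b ∉ s)
    (hφ : Cost S n {φ}) : Cost S (n + 14 * s.card) {fun a => φ (a ∘ ρ)} := by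
  induction s using Finset.induction_on generalizing ρ with
  | empty =>
    obtain rfl : ρ = id := funext fun b => hρ b (by simp)
    simpa using hφ
  | insert q s hq ih =>
    have := ih (Function.update ρ q q) (fun b hb => ?_) (fun b hb => ?_)
    · refine (this.assign (bit (ρ q)) q).mono subset_rfl
        (by rw [Finset.card_insert_of_notMem hq]; omega) ?_
      rw [Set.singleton_subset_iff, Set.mem_singleton_iff]
      funext a
      congr 1
      funext b
      by_cases hb : b = q
      · subst hb; simp
      · have : ρ b ≠ q := fun h => by
          by_cases hbs : b ∈ s
          · exact hρs b (by simp [hbs]) (by simp [h])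
          · exact hb ((hρ b (by simp [hb, hbs])).symm.trans h)
        simp [hb, this]
    · by_cases h : b = q
      · subst h; simp
      · rw [Function.update_of_ne h, hρ b (by simp [h, hb])]
    · have h : b ≠ q := fun h => hq (h ▸ hb)
      rw [Function.update_of_ne h]
      exact fun h' => hρs b (by simp [hb]) (by simp [h'])

/-- The node of φ is shared by both projections, so the cost grows by a constant instead of
doubling. Iteration yields sums of exponentially many terms. -/
theorem sum_bit (hφ : Cost S n {φ}) (b : B) :
    Cost S (n + 4) {fun a => ∑ c : Bool, φ (Function.update a b c)} := by
  have h1 : Cost (S ∪ {φ}) 0 {φ} := of_mem (by simp)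
  refine (hφ.trans ((h1.proj b true).add (h1.proj b false))).mono subset_rfl (by omega) ?_
  simp

theorem sum_fin {κ : ℕ} (hφ : Cost S n {φ}) (e : Fin κ → B) (he : Function.Injective e) :
    Cost S (n + 4 * κ) {fun a => ∑ x : Fin κ → Bool, φ (Function.extend e x a)} := by
  induction κ with
  | zero =>
    refine hφ.mono subset_rfl (by omega) ?_
    rw [Set.singleton_subset_iff, Set.mem_singleton_iff]
    funext a
    rw [Fintype.sum_unique]
    congr 1
    funext b
    rw [Function.extend_apply' _ _ _ (by simp)]
  | succ κ ih =>
    have := (ih (fun i => e i.succ) (he.comp (Fin.succ_injective κ))).sum_bit (e 0)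
    refine this.mono subset_rfl (by omega) ?_
    rw [Set.singleton_subset_iff, Set.mem_singleton_iff]
    funext a
    rw [← (Fin.consEquiv fun _ => Bool).sum_comp, Fintype.sum_prod_type]
    refine Finset.sum_congr rfl fun c _ => Finset.sum_congr rfl fun x _ => congrArg φ ?_
    funext b
    by_cases hb : ∃ i, e i = b
    · obtain ⟨i, rfl⟩ := hb
      rw [he.extend_apply]
      cases i using Fin.cases with
      | zero =>
        rw [Function.extend_apply' _ _ _ (by rintro ⟨i, hi⟩; exact Fin.succ_ne_zero i (he hi))]
        simp [Fin.consEquiv]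
      | succ i =>
        have := (he.comp (Fin.succ_injective κ)).extend_apply x (Function.update a (e 0) c) i
        exact this.symm
    · rw [Function.extend_apply' _ _ _ hb, Function.extend_apply' _ _ _
        (by rintro ⟨i, hi⟩; exact hb ⟨_, hi⟩), Function.update_of_ne (by rintro rfl; exact hb ⟨0, rfl⟩)]

theorem sum_bits {J : Type*} [Fintype J] [DecidableEq J] (hφ : Cost S n {φ}) (e : J → B)
    (he : Function.Injective e) :
    Cost S (n + 4 * Fintype.card J)
      {fun a => ∑ x : J → Bool, φ (Function.extend e x a)} := by
  let ε := Fintype.equivFin J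
  refine (sum_fin hφ (e ∘ ε.symm) (he.comp ε.symm.injective)).mono subset_rfl le_rfl ?_
  rw [Set.singleton_subset_iff, Set.mem_singleton_iff]
  funext a
  rw [← (Equiv.arrowCongr ε (Equiv.refl Bool)).sum_comp]
  refine Finset.sum_congr rfl fun x _ => congrArg φ ?_
  funext b
  by_cases hb : ∃ i, e i = b
  · obtain ⟨i, rfl⟩ := hb
    rw [he.extend_apply]
    have := (he.comp ε.symm.injective).extend_apply (x ∘ ε.symm) a (ε i)
    rw [Function.comp_apply, Function.comp_apply, Equiv.symm_apply_apply] at this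
    exact this.symm
  · rw [Function.extend_apply' _ _ _ hb, Function.extend_apply' _ _ _
      (by rintro ⟨i, hi⟩; exact hb ⟨_, hi⟩)]

end ProjCircuit.Cost

/-! ### Used nodes, elimination of auxiliary variables, substitution -/

namespace ProjCircuit

variable {F Y B : Type*}

/-- The nodes that are the output or the tail of a wire. -/
noncomputable def touched {V : Type*} (C : ProjCircuit F V) : Finset C.Node := by
  classical
  exact insert C.output (Finset.univ.biUnion fun v => (C.gate v).children.toFinset)

theorem card_touched_le {V : Type*} (C : ProjCircuit F V) : C.touched.card ≤ C.size + 1 := by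
  classical
  refine (Finset.card_insert_le _ _).trans (Nat.add_le_add_right ?_ 1)
  exact Finset.card_biUnion_le.trans (Finset.sum_le_sum fun v _ => List.toFinset_card_le _)

theorem mem_touched {V : Type*} (C : ProjCircuit F V) {u v : C.Node}
    (h : u ∈ (C.gate v).children) : u ∈ C.touched := by
  classical
  exact Finset.mem_insert_of_mem (Finset.mem_biUnion.2 ⟨v, Finset.mem_univ _, by simpa using h⟩)

theorem output_mem_touched {V : Type*} (C : ProjCircuit F V) : C.output ∈ C.touched := by
  classical
  exact Finset.mem_insert_self _ _

/-- The variables that label leaves which are the output or the tail of a wire. -/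
noncomputable def leafVars {V : Type*} (C : ProjCircuit F V) : Finset V := by
  classical
  exact C.touched.biUnion fun v => match C.gate v with
    | .var y => {y}
    | _ => ∅

theorem card_leafVars_le {V : Type*} (C : ProjCircuit F V) : C.leafVars.card ≤ C.size + 1 := by
  classical
  refine (Finset.card_biUnion_le_card_mul _ _ 1 fun v _ => ?_).trans
    ((mul_one _).le.trans C.card_touched_le)
  split <;> simp

theorem mem_leafVars {V : Type*} (C : ProjCircuit F V) {v : C.Node} (hv : v ∈ C.touched) {y : V}
    (h : C.gate v = .var y) : y ∈ C.leafVars := by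
  classical
  exact Finset.mem_biUnion.2 ⟨v, hv, by rw [h]; simp⟩

variable [Field F]

/-- Set finitely many auxiliary variables to `0`. -/
theorem exists_poly_eq_aeval (C : ProjCircuit F (Y ⊕ B)) (v : C.Node) (s : Finset B)
    [DecidableEq B] :
    ∃ C' : ProjCircuit F (Y ⊕ B), C'.size ≤ C.size + s.card ∧
      C'.poly = aeval (Sum.elim (fun y => X (Sum.inl y))
        fun b => if b ∈ s then (0 : MvPolynomial (Y ⊕ B) F) else X (Sum.inr b)) (C.value v) := by
  classical
  induction s using Finset.induction_on with
  | empty =>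
    refine ⟨{ C with output := v }, le_rfl, ?_⟩
    have : (Sum.elim (fun y => X (Sum.inl y)) fun b => if b ∈ (∅ : Finset B) then
        (0 : MvPolynomial (Y ⊕ B) F) else X (Sum.inr b)) = X := by
      funext x; cases x <;> simp
    rw [this, aeval_X_left_apply]
    rfl
  | insert b s hb ih =>
    obtain ⟨C', h1, h2⟩ := ih
    refine ⟨C'.extend (.proj (.inr b) false C'.output), ?_, ?_⟩
    · rw [size_extend, Finset.card_insert_of_notMem hb]
      simp only [Gate.children, List.length_singleton]
      omega
    · rw [poly_extend]
      change projection _ _ C'.poly = _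
      rw [h2]
      unfold projection
      rw [← AlgHom.comp_apply]
      congr 1
      ext x : 1
      rcases x with x | x
      · simp
      · by_cases hx : x ∈ s
        · simp [hx]
        · by_cases hxb : x = b
          · subst hxb; simp [hx]
          · simp [hx, hxb]

/-- `Cost` controls only Boolean values of the auxiliary variables, so these may still occur
formally. Projecting each of them to 0 removes them, at one wire apiece. -/
theorem Cost.exists_computes {N n : ℕ} [Fintype B] {A : MvPolynomial (Fin n) F}
    (h : Cost (B := B) ∅ N {fun _ => A}) :
    ∃ (k : ℕ) (C : ProjCircuit F (Fin n ⊕ Fin k)),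
      C.size ≤ N + Fintype.card B ∧ C.Computes A := by
  classical
  let C₀ : ProjCircuit F (Fin n ⊕ B) :=
    { Node := Unit, gate := fun _ => .const 0, acyclic := ⟨fun _ => ⟨_, fun _ h => by
        simp [Gate.children] at h⟩⟩, output := () }
  have h₀ : C₀.size = 0 := by simp [size, C₀, Gate.children]
  obtain ⟨C₁, -, h1, h2⟩ := h C₀ (Set.empty_subset _)
  obtain ⟨v, hv⟩ := h1 rfl
  obtain ⟨C₂, h3, h4⟩ := C₁.exists_poly_eq_aeval v Finset.univ
  let e : Fin n ⊕ B ≃ Fin n ⊕ Fin (Fintype.card B) :=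
    (Equiv.refl _).sumCongr (Fintype.equivFin B)
  refine ⟨Fintype.card B, C₂.mapVar e, ?_, ?_⟩
  · rw [size_mapVar, ← Finset.card_univ]; omega
  · change (C₂.mapVar e).value _ = _
    rw [value_mapVar _ _ e.injective]
    change rename e C₂.poly = _
    rw [h4, ← congrFun hv fun _ => false]
    simp only [bitEval]
    rw [← AlgHom.comp_apply, ← AlgHom.comp_apply]
    congr 1
    ext x : 1
    rcases x with x | x <;> simp [e]

/-! ### Substitution into a circuit -/

theorem aeval_value_congr {V R : Type*} [CommRing R] [Algebra F R] (C : ProjCircuit F V)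
    {s s' : V → R} (h : ∀ y ∈ C.leafVars, s y = s' y) {v : C.Node} (hv : v ∈ C.touched) :
    aeval s (C.value v) = aeval s' (C.value v) := by
  classical
  induction v using C.acyclic.induction generalizing s s' with
  | _ v ih =>
    rw [value_eq]
    cases hg : C.gate v with
    | const a => simp [Gate.eval]
    | var x => simpa [Gate.eval] using h x (C.mem_leafVars hv hg)
    | sum l =>
      have hl : ∀ u ∈ l, u ∈ (C.gate v).children := fun u hu => by rw [hg]; exact hu
      rw [Gate.eval, map_list_sum, map_list_sum, List.map_map, List.map_map]
      exact congrArg _ (List.map_congr_left fun u hu => ih u (hl u hu) h (C.mem_touched (hl u hu)))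
    | prod l =>
      have hl : ∀ u ∈ l, u ∈ (C.gate v).children := fun u hu => by rw [hg]; exact hu
      rw [Gate.eval, map_list_prod, map_list_prod, List.map_map, List.map_map]
      exact congrArg _ (List.map_congr_left fun u hu => ih u (hl u hu) h (C.mem_touched (hl u hu)))
    | proj w b u =>
      have hu : u ∈ (C.gate v).children := by rw [hg]; exact List.mem_singleton.2 rfl
      rw [Gate.eval, aeval_projection, aeval_projection]
      refine ih u hu (fun y hy => ?_) (C.mem_touched hu)
      by_cases hyw : y = w
      · subst hyw; simp
      · rw [Function.update_of_ne hyw, Function.update_of_ne hyw, h y hy]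

/-- Process the nodes of a circuit along the wires. -/
theorem Cost.touched {V : Type*} (C : ProjCircuit F V)
    (Φ : C.Node → (B → Bool) → MvPolynomial Y F) (c : C.Node → ℕ)
    (h : ∀ v ∈ C.touched, Cost (Φ '' {u | u ∈ (C.gate v).children}) (c v) {Φ v}) :
    Cost ∅ (∑ v ∈ C.touched, c v) (Φ '' C.touched) := by
  classical
  suffices H : ∀ (k : ℕ) (P : Finset C.Node), P ⊆ C.touched → (C.touched \ P).card = k →
      Cost (Φ '' P) (∑ v ∈ C.touched \ P, c v) (Φ '' C.touched) by
    simpa using H _ ∅ (by simp) rfl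
  intro k
  induction k with
  | zero =>
    intro P hP hk
    have : C.touched ⊆ P := by simpa using hk
    exact (Cost.of_subset (Set.image_mono (by exact_mod_cast this))).mono_cost (Nat.zero_le _)
  | succ k ih =>
    intro P hP hk
    -- All children of a minimal unprocessed node are processed already.
    obtain ⟨v, hv, hmin⟩ := C.acyclic.has_min {v | v ∈ C.touched \ P}
      (Finset.card_pos.1 (by omega : 0 < (C.touched \ P).card))
    have hv' := Finset.mem_sdiff.1 hv
    have h1 : Cost (Φ '' P) (c v) {Φ v} := by
      refine (h v hv'.1).mono_left (Set.image_mono fun u hu => ?_)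
      by_contra huP
      exact hmin u (Finset.mem_sdiff.2 ⟨C.mem_touched hu, huP⟩) hu
    have hs : C.touched \ insert v P = (C.touched \ P).erase v := by
      ext u; simp; tauto
    have h2 := ih (insert v P) (Finset.insert_subset hv'.1 hP)
      (by rw [hs, Finset.card_erase_of_mem hv]; omega)
    have h3 := h1.trans (h2.mono_left (S' := Φ '' P ∪ {Φ v}) (by
      rw [Finset.coe_insert, Set.image_insert_eq, Set.insert_eq, Set.union_comm]))
    refine h3.mono_cost ?_
    rw [hs, Finset.add_sum_erase _ _ hv]

/-- Plain replacement of leaves would be wrong below a gate that projects the replaced variable. So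
each leaf variable w gets two bits: `t w` tells whether w is projected, and `r w` to which constant.
A leaf selects between this constant and σ, and a projection gate of w becomes a setting of the two
bits. -/
theorem Cost.subst {V : Type*} (C : ProjCircuit F V) [DecidableEq B] [DecidableEq V]
    (t r : C.leafVars → B) (ht : Function.Injective t) (hr : Function.Injective r)
    (htr : ∀ w w', t w ≠ r w')
    (σ : V → (B → Bool) → MvPolynomial Y F) {L : ℕ} (hσ : ∀ y, Cost ∅ L {σ y})
    (hσt : ∀ y a w b, σ y (Function.update a (t w) b) = σ y a)
    (hσr : ∀ y a w b, σ y (Function.update a (r w) b) = σ y a) :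
    Cost ∅ ((C.size + 1) * (L + 15) + C.size) {fun a => aeval (fun y => σ y a) C.poly} := by
  have htr' : ∀ w w', r w' ≠ t w := fun w w' => (htr w w').symm
  let sub (a : B → Bool) (y : V) : MvPolynomial Y F :=
    if h : y ∈ C.leafVars then
      if a (t ⟨y, h⟩) then if a (r ⟨y, h⟩) then 1 else 0 else σ y a
    else σ y a
  let Φ (v : C.Node) (a : B → Bool) : MvPolynomial Y F := aeval (sub a) (C.value v)
  have key : ∀ v ∈ C.touched, Cost (Φ '' {u | u ∈ (C.gate v).children})
      (L + 14 + (C.gate v).children.length) {Φ v} := by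
    intro v hv
    have hΦ : Φ v = fun a => aeval (sub a) ((C.gate v).eval C.value) := by
      funext a; rw [← value_eq]
    cases hg : C.gate v with
    | const x =>
      rw [hΦ, hg]
      refine (Cost.const x).mono (Set.empty_subset _) (Nat.zero_le _) ?_
      simp [Gate.eval]
    | var y =>
      have hy := C.mem_leafVars hv hg
      refine (((Cost.bit (t ⟨y, hy⟩)).ite (Cost.bit (r ⟨y, hy⟩)) (hσ y))).mono
        (Set.empty_subset _) (by omega) ?_
      rw [hΦ, hg]
      simp [Gate.eval, sub, hy]
    | sum l =>
      refine (Cost.list_sum (l.map Φ) ?_).mono subset_rfl ?_ ?_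
      · simpa using fun u hu => ⟨u, hu, rfl⟩
      · simp [Gate.children]
      · rw [hΦ, hg, Set.singleton_subset_iff, Set.mem_singleton_iff]
        funext a
        rw [Gate.eval, map_list_sum, ← Pi.evalAddMonoidHom_apply (fun _ => MvPolynomial Y F) a
          (l.map Φ).sum, map_list_sum, List.map_map, List.map_map]
        rfl
    | prod l =>
      refine (Cost.list_prod (l.map Φ) ?_).mono subset_rfl ?_ ?_
      · simpa using fun u hu => ⟨u, hu, rfl⟩
      · simp [Gate.children]
      · rw [hΦ, hg, Set.singleton_subset_iff, Set.mem_singleton_iff]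
        funext a
        rw [Gate.eval, map_list_prod, ← Pi.evalMonoidHom_apply (fun _ => MvPolynomial Y F) a
          (l.map Φ).prod, map_list_prod, List.map_map, List.map_map]
        rfl
    | proj w b u =>
      have hu : u ∈ C.touched := C.mem_touched (v := v) (by rw [hg]; exact List.mem_singleton.2 rfl)
      have h0 : Cost (Φ '' {u' | u' ∈ (Gate.proj (F := F) w b u).children}) 0 {Φ u} :=
        Cost.of_mem ⟨u, List.mem_singleton.2 rfl, rfl⟩
      by_cases hw : w ∈ C.leafVars
      · refine ((h0.proj (t ⟨w, hw⟩) true).proj (r ⟨w, hw⟩) b).mono subset_rfl (by omega) ?_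
        rw [hΦ, hg, Set.singleton_subset_iff, Set.mem_singleton_iff]
        funext a
        rw [Gate.eval, aeval_projection]
        refine congrArg (fun s => aeval s (C.value u)) ?_
        funext y
        by_cases hyw : y = w
        · subst hyw
          simp [sub, hw, htr']
        · have h1 : ∀ hy : y ∈ C.leafVars, t ⟨y, hy⟩ ≠ t ⟨w, hw⟩ := fun hy h =>
            hyw (congrArg Subtype.val (ht h))
          have h2 : ∀ hy : y ∈ C.leafVars, r ⟨y, hy⟩ ≠ r ⟨w, hw⟩ := fun hy h =>
            hyw (congrArg Subtype.val (hr h))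
          by_cases hy : y ∈ C.leafVars
          · simp [sub, hy, hyw, hσt, hσr, h1 hy, h2 hy, htr, htr']
          · simp [sub, hy, hyw, hσt, hσr]
      -- No used leaf carries `w`, so this projection changes nothing.
      · refine h0.mono subset_rfl (by omega) ?_
        rw [hΦ, hg, Set.singleton_subset_iff, Set.mem_singleton_iff]
        funext a
        rw [Gate.eval, aeval_projection]
        refine C.aeval_value_congr (fun y hy => ?_) hu
        rw [Function.update_of_ne (by rintro rfl; exact hw hy)]
  have h1 := (Cost.touched C Φ _ key).mono (T' := {Φ C.output}) subset_rfl le_rfl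
    (Set.singleton_subset_iff.2 ⟨_, C.output_mem_touched, rfl⟩)
  -- At the output nothing is projected yet: all switches are off, and the bits `r` become
  -- irrelevant.
  have h2 := h1.clear (Finset.univ.image t)
  refine h2.mono subset_rfl ?_ ?_
  · have h3 : (Finset.univ.image t).card ≤ C.size + 1 :=
      Finset.card_image_le.trans (by simpa using C.card_leafVars_le)
    have h4 : ∑ v ∈ C.touched, (C.gate v).children.length ≤ C.size :=
      Finset.sum_le_sum_of_subset (Finset.subset_univ _)
    have h5 := Nat.mul_le_mul_right (L + 14) C.card_touched_le
    rw [Finset.sum_add_distrib, Finset.sum_const, smul_eq_mul]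
    nlinarith
  · rw [Set.singleton_subset_iff, Set.mem_singleton_iff]
    funext a
    refine C.aeval_value_congr (fun y hy => ?_) C.output_mem_touched
    have hσc : ∀ s : Finset B, s ⊆ Finset.univ.image t →
        σ y (fun b => if b ∈ s then false else a b) = σ y a := by
      intro s
      induction s using Finset.induction_on with
      | empty => simp
      | insert b s hb ih =>
        intro hs
        obtain ⟨w, -, rfl⟩ := Finset.mem_image.1 (hs (Finset.mem_insert_self _ _))
        rw [← ih fun x hx => hs (Finset.mem_insert_of_mem hx), ← hσt y (fun b => if b ∈ s then false else a b) w false]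
        congr 1
        funext x
        by_cases hx : x = t w
        · subst hx; simp
        · simp [hx]
    have hty : t ⟨y, hy⟩ ∈ Finset.univ.image t := Finset.mem_image_of_mem _ (Finset.mem_univ _)
    simp only [sub, dif_pos hy, if_pos hty, Bool.false_eq_true, if_false]
    exact (hσc _ subset_rfl).symm

end ProjCircuit

/-! ### Products and powers of exponentially large matrices -/

namespace ProjCircuit.Cost

variable {F Y B J : Type*} [Field F] {S : Set ((B → Bool) → MvPolynomial Y F)} {n k : ℕ}
  [DecidableEq B] [Fintype J]

/-- Move the contents of a register. -/
theorem move {φ : (B → Bool) → MvPolynomial Y F} (hφ : Cost S n {φ}) (e e' : J → B)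
    (he : Function.Injective e) (hee' : ∀ i j, e i ≠ e' j) :
    Cost S (n + 14 * Fintype.card J) {fun a => φ (a ∘ Function.extend e e' id)} := by
  have := hφ.comp (Finset.univ.image e) (Function.extend e e' id) (fun b hb => ?_) (fun b hb => ?_)
  · rwa [Finset.card_image_of_injective _ he, Finset.card_univ] at this
  · rw [Function.extend_apply' _ _ _ (by simpa using hb)]; rfl
  · obtain ⟨i, -, rfl⟩ := Finset.mem_image.1 hb
    rw [he.extend_apply]
    simpa using fun j => hee' j i

variable [DecidableEq J]

/-- Register 2 holds the summation index: it replaces the column register of M and the row register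
of N, and is then summed out. -/
theorem matrix_mul {e : Fin 3 → J → B} (he : Function.Injective (Function.uncurry e))
    {M N : Matrix (J → Bool) (J → Bool) (MvPolynomial Y F)}
    (hM : Cost S n {fun a => M (a ∘ e 0) (a ∘ e 1)})
    (hN : Cost S k {fun a => N (a ∘ e 0) (a ∘ e 1)}) :
    Cost S (n + k + 32 * Fintype.card J + 2) {fun a => (M * N) (a ∘ e 0) (a ∘ e 1)} := by
  have hinj : ∀ i, Function.Injective (e i) := fun i x y h =>
    congrArg Prod.snd (he (a₁ := (i, x)) (a₂ := (i, y)) h)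
  have hne : ∀ i j, i ≠ j → ∀ x y, e i x ≠ e j y := fun i j hij x y h =>
    hij (congrArg Prod.fst (he (a₁ := (i, x)) (a₂ := (j, y)) h))
  have h1 := hM.move (e 1) (e 2) (hinj 1) (hne 1 2 (by decide))
  have h2 := hN.move (e 0) (e 2) (hinj 0) (hne 0 2 (by decide))
  refine ((h1.mul h2).sum_bits (e 2) (hinj 2)).mono subset_rfl (by omega) ?_
  rw [Set.singleton_subset_iff, Set.mem_singleton_iff]
  funext a
  rw [Matrix.mul_apply]
  have hext : ∀ (i j : Fin 3) (x : J → Bool), i ≠ 2 → i ≠ j →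
      (Function.extend (e 2) x a ∘ Function.extend (e j) (e 2) id) ∘ e i = a ∘ e i := by
    intro i j x hi hij
    funext q
    simp only [Function.comp_apply]
    rw [Function.extend_apply' (f := e j) _ _ _ fun ⟨q', h⟩ => hne j i hij.symm _ _ h, id,
      Function.extend_apply' _ _ _ fun ⟨q', h⟩ => hne 2 i hi.symm _ _ h]
  have hext' : ∀ (j : Fin 3) (x : J → Bool),
      (Function.extend (e 2) x a ∘ Function.extend (e j) (e 2) id) ∘ e j = x := by
    intro j x
    funext q
    simp only [Function.comp_apply]
    rw [(hinj j).extend_apply, (hinj 2).extend_apply]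
  refine Finset.sum_congr rfl fun x _ => ?_
  rw [hext 0 1 x (by decide) (by decide), hext' 1, hext 1 0 x (by decide) (by decide), hext' 0]

theorem matrix_pow {e : Fin 3 → J → B} (he : Function.Injective (Function.uncurry e))
    {M N : Matrix (J → Bool) (J → Bool) (MvPolynomial Y F)}
    (hM : Cost S n {fun a => M (a ∘ e 0) (a ∘ e 1)})
    (hN : Cost S k {fun a => N (a ∘ e 0) (a ∘ e 1)}) (b : ℕ) :
    Cost S (n + k + b * (64 * Fintype.card J + 4))
      {fun a => (M ^ (2 ^ b - 1) * N) (a ∘ e 0) (a ∘ e 1)} := by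
  -- Both matrices are carried along, so that each round adds two products to existing nodes and the
  -- cost stays linear in `b`.
  suffices H : Cost S (n + k + b * (64 * Fintype.card J + 4))
      ({fun a => (M ^ 2 ^ b) (a ∘ e 0) (a ∘ e 1)} ∪
        {fun a => (M ^ (2 ^ b - 1) * N) (a ∘ e 0) (a ∘ e 1)}) from
    H.mono subset_rfl le_rfl Set.subset_union_right
  induction b with
  | zero => simpa using hM.union hN
  | succ b ih =>
    have h1 : Cost (S ∪ ({fun a => (M ^ 2 ^ b) (a ∘ e 0) (a ∘ e 1)} ∪
        {fun a => (M ^ (2 ^ b - 1) * N) (a ∘ e 0) (a ∘ e 1)})) 0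
        {fun a => (M ^ 2 ^ b) (a ∘ e 0) (a ∘ e 1)} := of_mem (by simp)
    have h2 : Cost (S ∪ ({fun a => (M ^ 2 ^ b) (a ∘ e 0) (a ∘ e 1)} ∪
        {fun a => (M ^ (2 ^ b - 1) * N) (a ∘ e 0) (a ∘ e 1)})) 0
        {fun a => (M ^ (2 ^ b - 1) * N) (a ∘ e 0) (a ∘ e 1)} := of_mem (by simp)
    have h3 := ih.trans ((matrix_mul he h1 h1).union (matrix_mul he h1 h2))
    have hp : M ^ 2 ^ b * M ^ 2 ^ b = M ^ 2 ^ (b + 1) := by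
      rw [← pow_add]; congr 1; ring
    have hq : M ^ 2 ^ b * (M ^ (2 ^ b - 1) * N) = M ^ (2 ^ (b + 1) - 1) * N := by
      rw [← mul_assoc, ← pow_add]
      congr 2
      have := Nat.one_le_two_pow (n := b)
      rw [pow_succ]; omega
    rw [hp, hq] at h3
    exact h3.mono_cost (by ring_nf; omega)

end ProjCircuit.Cost

/-- Bit strings as binary digits. -/
noncomputable def bitsEquiv (κ : ℕ) : (Fin κ → Bool) ≃ Fin (2 ^ κ) :=
  Equiv.ofBijective (fun x => ⟨Nat.ofBits x, Nat.ofBits_lt_two_pow x⟩)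
    ((Fintype.bijective_iff_injective_and_card _).2
      ⟨fun _ _ h => Nat.ofBits_injective (congrArg Fin.val h), by simp⟩)

theorem bitsEquiv_lt {κ : ℕ} (x y : Fin κ → Bool) :
    bitsEquiv κ x < bitsEquiv κ y ↔ Nat.ofBits x < Nat.ofBits y := Iff.rfl

/-- A pair of bit strings as a pair of numbers. -/
noncomputable def pairEquiv (κ : ℕ) : (Bool × Fin κ → Bool) ≃ Fin (2 ^ κ) × Fin (2 ^ κ) where
  toFun x := (bitsEquiv κ fun q => x (false, q), bitsEquiv κ fun q => x (true, q))
  invFun p q := if q.1 then (bitsEquiv κ).symm p.2 q.2 else (bitsEquiv κ).symm p.1 q.2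
  left_inv x := by
    funext ⟨b, q⟩
    cases b <;> simp
  right_inv p := by simp

/-! ### Determinants of exponentially large matrices -/

namespace ProjCircuit.Cost

variable {F Y B : Type*} [Field F] {S : Set ((B → Bool) → MvPolynomial Y F)} {n k : ℕ}

theorem pow_two_pow {φ : (B → Bool) → MvPolynomial Y F} (h : Cost S n {φ}) (b : ℕ) :
    Cost S (n + 2 * b) {fun a => φ a ^ 2 ^ b} := by
  induction b with
  | zero => simpa using h
  | succ b ih =>
    have h1 : Cost (S ∪ {fun a => φ a ^ 2 ^ b}) 0 {fun a => φ a ^ 2 ^ b} := of_mem (by simp)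
    refine (ih.trans (h1.mul h1)).mono subset_rfl (by omega) ?_
    simp [← pow_add, pow_succ, mul_two]

theorem powBits {N β : ℕ} {y : Fin N → (B → Bool) → MvPolynomial Y F}
    (h : ∀ i, Cost S n {y i}) (c : Fin (N * β) → B) :
    Cost S (N * β * (n + 2 * β + 13)) {fun a => powBits (fun i => y i a) (a ∘ c)} := by
  have := prod (I := Fin N × Fin β) (n := n + 2 * β + 12) fun q =>
    ((bit (S := S) (c (finProdFinEquiv q))).ite ((h q.1).pow_two_pow q.2.val) one).mono_cost
      (by have := q.2.2; omega)
  refine this.mono subset_rfl (by simp) ?_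
  rw [Set.singleton_subset_iff, Set.mem_singleton_iff]
  funext a
  rw [powBits_eq_prod]
  rfl

theorem const_pow_ofBits {κ : ℕ} (x : F) (c : Fin κ → B) :
    Cost S (κ * 13) {fun a => C (x ^ Nat.ofBits (a ∘ c))} := by
  have := prod (S := S) fun i : Fin κ => (bit (c i)).ite (const (x ^ 2 ^ i.val)) one
  refine this.mono subset_rfl (by simp) ?_
  rw [Set.singleton_subset_iff, Set.mem_singleton_iff]
  funext a
  rw [pow_ofBits, map_prod]
  exact Finset.prod_congr rfl fun i _ => by cases h : a (c i) <;> simp [h]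

variable [DecidableEq B]

/-- The clow formula needs the power 2 ^ κ - 1 of a matrix on states, that is, κ squaring rounds. In
each register, `false` marks the bits of the head and `true` those of the current vertex. -/
theorem det {κ : ℕ} {e : Fin 3 → Bool × Fin κ → B} (he : Function.Injective (Function.uncurry e))
    {P : Matrix (Fin κ → Bool) (Fin κ → Bool) (MvPolynomial Y F)}
    (hP : Cost S n {fun a => P (fun q => a (e 0 (true, q))) (fun q => a (e 1 (true, q)))}) :
    Cost S (3 * n + 200 * (κ + 1) ^ 2) {fun _ => P.det} := by
  have hinj : ∀ i, Function.Injective (e i) := fun i x y h =>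
    congrArg Prod.snd (he (a₁ := (i, x)) (a₂ := (i, y)) h)
  have hne : ∀ i j, i ≠ j → ∀ x y, e i x ≠ e j y := fun i j hij x y h =>
    hij (congrArg Prod.fst (he (a₁ := (i, x)) (a₂ := (j, y)) h))
  let Q := P.submatrix (bitsEquiv κ).symm (bitsEquiv κ).symm
  let M := (clowMatrix Q).submatrix (pairEquiv κ) (pairEquiv κ)
  -- The final weights form a vector; constant rows make it a matrix, so `matrix_pow` applies and
  -- the column register has no influence.
  let W : Matrix (Bool × Fin κ → Bool) (Bool × Fin κ → Bool) (MvPolynomial Y F) :=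
    Matrix.of fun x _ => clowEnd Q (pairEquiv κ x)
  -- The weight of closing a walk leads from the current vertex to the head of the same state, so
  -- the column bits are read from register 0.
  have hP' : Cost S (n + 14 * κ)
      {fun a => P (fun q => a (e 0 (true, q))) (fun q => a (e 0 (false, q)))} := by
    have hi : Function.Injective fun q => e 1 (true, q) := fun q q' h =>
      congrArg Prod.snd (hinj 1 h)
    refine (hP.move (fun q : Fin κ => e 1 (true, q)) (fun q => e 0 (false, q)) hi
      fun _ _ => hne 1 0 (by decide) _ _).mono subset_rfl (by simp) ?_
    rw [Set.singleton_subset_iff, Set.mem_singleton_iff]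
    funext a
    congr 1
    · funext q
      rw [Function.comp_apply, Function.extend_apply' _ _ _
        fun ⟨q', h⟩ => hne 1 0 (by decide) _ _ h, id]
    · funext q
      rw [Function.comp_apply, hi.extend_apply (fun q => e 0 (false, q)) id q]
  have hbit : ∀ i b q, Cost S 0 {fun a => if a (e i (b, q)) then 1 else 0} := fun i b q => bit _
  have hlt := fun i b j b' => lt (hbit i b) (hbit j b')
  have heq := fun i b j b' => eq (hbit i b) (hbit j b')
  have hM : Cost S (2 * n + 40 * κ ^ 2 + 100 * κ + 50) {fun a => M (a ∘ e 0) (a ∘ e 1)} := by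
    have h1 := ((heq 1 false 0 false).and (hlt 1 true 0 false))
    have h2 := ((hlt 1 false 0 false).and (heq 1 true 1 false))
    have h3 := (h1.mul hP).sub (h2.mul hP')
    refine h3.mono subset_rfl ?_ ?_
    · simp only [Fintype.card_fin]
      nlinarith
    · rw [Set.singleton_subset_iff, Set.mem_singleton_iff]
      funext a
      simp [M, Q, clowMatrix, pairEquiv, bitsEquiv_lt]
  have hW : Cost S (n + 14 * κ + 2) {fun a => W (a ∘ e 0) (a ∘ e 1)} := by
    refine hP'.neg.mono subset_rfl le_rfl ?_
    rw [Set.singleton_subset_iff, Set.mem_singleton_iff]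
    funext a
    simp [W, Q, clowEnd, pairEquiv]
  have hpow := matrix_pow he hM hW κ
  have hd := ((((heq 0 false 0 true).mul hpow).sum_bits (e 0) (hinj 0)).mul
    (const ((-1) ^ 2 ^ κ)))
  refine hd.mono subset_rfl ?_ ?_
  · simp only [Fintype.card_fin, Fintype.card_prod, Fintype.card_bool]
    nlinarith
  · rw [Set.singleton_subset_iff, Set.mem_singleton_iff]
    funext a
    have hdet : Q.det = P.det := Matrix.det_submatrix_equiv_self _ _
    have hsign : ((-1 : MvPolynomial Y F) ^ 2 ^ κ) * (-1) ^ 2 ^ κ = 1 := by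
      rw [← mul_pow]; simp
    have hclow := det_eq_sum_clow (pow_pos (by norm_num) κ) Q
    have hMW : ∀ x y, (M ^ (2 ^ κ - 1) * W) x y =
        ((clowMatrix Q ^ (2 ^ κ - 1)).mulVec (clowEnd Q)) (pairEquiv κ x) := by
      intro x y
      have hMp : M ^ (2 ^ κ - 1) =
          (clowMatrix Q ^ (2 ^ κ - 1)).submatrix (pairEquiv κ) (pairEquiv κ) :=
        (map_pow (Matrix.reindexAlgEquiv ℤ (MvPolynomial Y F) (pairEquiv κ).symm)
          (clowMatrix Q) (2 ^ κ - 1)).symm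
      rw [hMp, Matrix.mul_apply, Matrix.mulVec, dotProduct, ← (pairEquiv κ).sum_comp]
      rfl
    simp only [hMW]
    have hsum : P.det = (-1) ^ 2 ^ κ * ((-1) ^ 2 ^ κ * Q.det) := by
      rw [← mul_assoc, hsign, one_mul, hdet]
    rw [hsum, hclow, mul_comm, map_pow, map_neg, C_1]
    congr 1
    rw [← Fintype.sum_equiv (pairEquiv κ).symm
      (fun p => if p.1 = p.2 then ((clowMatrix Q ^ (2 ^ κ - 1)).mulVec (clowEnd Q)) p else 0)]
    · rw [Fintype.sum_prod_type]
      simp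
    · intro p
      have h1 : ∀ x : Bool × Fin κ → Bool, ∀ b q, Function.extend (e 0) x a (e 0 (b, q)) = x (b, q) :=
        fun x b q => (hinj 0).extend_apply _ _ _
      have h2 : ∀ x : Bool × Fin κ → Bool, Function.extend (e 0) x a ∘ e 0 = x :=
        fun x => funext fun q => (hinj 0).extend_apply _ _ _
      simp only [h1, h2, Equiv.apply_symm_apply]
      have h3 : ((fun q => (pairEquiv κ).symm p (false, q)) =
          fun q => (pairEquiv κ).symm p (true, q)) ↔ p.1 = p.2 := by
        simp only [pairEquiv, Equiv.coe_fn_symm_mk]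
        simp
      simp only [h3]
      split_ifs <;> simp

end ProjCircuit.Cost

/-! ### The annihilator -/

section PowBits

variable {F : Type*} [Field F] {N β : ℕ}

theorem Nat.ofBits_le {κ : ℕ} (x : Fin κ → Bool) : Nat.ofBits x ≤ 2 ^ κ - 1 :=
  Nat.le_sub_one_of_lt (Nat.ofBits_lt_two_pow x)

theorem totalDegree_powBits_le {m d : ℕ} (g : Fin N → MvPolynomial (Fin m) F)
    (hg : ∀ i, (g i).totalDegree ≤ d) (x : Fin (N * β) → Bool) :
    (powBits g x).totalDegree ≤ N * d * (2 ^ β - 1) := by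
  refine (totalDegree_finsetProd _ _).trans ?_
  calc _ ≤ ∑ _i : Fin N, (2 ^ β - 1) * d := Finset.sum_le_sum fun i _ =>
        (totalDegree_pow _ _).trans (Nat.mul_le_mul (Nat.ofBits_le _) (hg i))
    _ = _ := by simp; ring

/-- The exponent of the monomial `powBits (fun i => X (ν i)) x`. -/
noncomputable def expBits {n : ℕ} (ν : Fin N → Fin n) (x : Fin (N * β) → Bool) : Fin n →₀ ℕ :=
  ∑ i, Finsupp.single (ν i) (Nat.ofBits fun b => x (finProdFinEquiv (i, b)))

theorem powBits_X {n : ℕ} (ν : Fin N → Fin n) (x : Fin (N * β) → Bool) :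
    powBits (fun i => (X (ν i) : MvPolynomial (Fin n) F)) x = monomial (expBits ν x) 1 := by
  rw [expBits, monomial_sum_one]
  exact Finset.prod_congr rfl fun i _ => X_pow_eq_monomial

variable {n : ℕ} {ν : Fin N → Fin n}

theorem expBits_apply (hν : Function.Injective ν) (x : Fin (N * β) → Bool) (i : Fin N) :
    expBits ν x (ν i) = Nat.ofBits fun b => x (finProdFinEquiv (i, b)) := by
  rw [expBits, Finsupp.finsetSum_apply, Finset.sum_eq_single i]
  · simp
  · intro j _ hj
    exact Finsupp.single_eq_of_ne (hν.ne hj.symm)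
  · simp

theorem expBits_le (hν : Function.Injective ν) (x : Fin (N * β) → Bool) (j : Fin n) : expBits ν x j ≤ 2 ^ β - 1 := by
  by_cases hj : ∃ i, ν i = j
  · obtain ⟨i, rfl⟩ := hj
    rw [expBits_apply hν]
    exact Nat.ofBits_le _
  · rw [expBits, Finsupp.finsetSum_apply, Finset.sum_eq_zero]
    · exact Nat.zero_le _
    · exact fun i _ => Finsupp.single_eq_of_ne fun h => hj ⟨i, h.symm⟩

theorem expBits_injective (hν : Function.Injective ν) :
    Function.Injective (expBits ν : (Fin (N * β) → Bool) → Fin n →₀ ℕ) := by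
  intro x y h
  funext q
  obtain ⟨⟨i, b⟩, rfl⟩ := finProdFinEquiv.surjective q
  have h1 := DFunLike.congr_fun h (ν i)
  rw [expBits_apply hν, expBits_apply hν] at h1
  exact congrFun (Nat.ofBits_injective h1) b

end PowBits

/-- An annihilator as a determinant. -/
theorem exists_annihilator {F : Type*} [Field F] [Infinite F] {m n d : ℕ} (hm : 3 ≤ m)
    (hd : 1 ≤ d) {β : ℕ} (hβ : 3 * m * d + 1 < 2 * 2 ^ β) (hβ' : 2 ^ β ≤ 3 * m * d + 1)
    {ν : Fin (2 * m) → Fin n} (hν : Function.Injective ν)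
    (g : Fin n → MvPolynomial (Fin m) F) (hg : ∀ i, (g i).totalDegree ≤ d)
    {L : ℕ} (hL : 2 * m * d * (2 ^ β - 1) < L) {γ : Fin L → F} (hγ : Function.Injective γ)
    (idxU : (Fin m × Fin L → Bool) → ℕ) (hU : Function.Injective idxU) :
    ∃ (r : Fin (2 * m * β) → Bool) (a : F) (A : MvPolynomial (Fin n) F),
      A ≠ 0 ∧ (∀ i, A.degreeOf i ≤ 3 * m * d) ∧ Annihilates A g ∧
      A = (prefixMatrix Nat.ofBits r ((gram idxU (fun u c =>
        powBits (fun i => eval (gridPoint γ u) (g (ν i))) c) a).map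
          (algebraMap F (MvPolynomial (Fin n) F))) (powBits fun i => X (ν i))).det := by
  let h : (Fin (2 * m * β) → Bool) → MvPolynomial (Fin m) F := powBits fun i => g (ν i)
  have hdeg : ∀ c, (h c).totalDegree ≤ 2 * m * d * (2 ^ β - 1) :=
    totalDegree_powBits_le _ fun i => hg (ν i)
  have hdep := exists_relation_of_totalDegree_le h hdeg (by
    have := choose_lt hm hd hβ
    rw [← pow_mul, ← pow_mul] at this
    rw [Fintype.card_fun, Fintype.card_bool, Fintype.card_fin]
    convert this using 2
    ring)
  let ev : (Fin m × Fin L → Bool) → MvPolynomial (Fin m) F →ₗ[F] F := fun u =>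
    (aeval (gridPoint γ u)).toLinearMap
  obtain ⟨r, a, hra, v, hv0, hv, hvr⟩ := exists_prefix_relation Nat.ofBits idxU hU h ev
    (fun v hv => eq_zero_of_eval_gridPoint γ hγ _ (lt_of_le_of_lt
      ((totalDegree_finsetSum _ _).trans (Finset.sup_le fun c _ =>
        (totalDegree_smul_le _ _).trans (hdeg c))) hL) hv) hdep
  have hev : (fun u c => powBits (fun i => eval (gridPoint γ u) (g (ν i))) c) =
      fun u c => ev u (h c) := by
    funext u c
    exact (map_powBits (eval (gridPoint γ u)) _ c).symm
  have hdet := det_prefixMatrix (R := MvPolynomial (Fin n) F) Nat.ofBits r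
    (gram idxU (fun u c => ev u (h c)) a) (powBits fun i => X (ν i))
  set G := gram idxU (fun u c => ev u (h c)) a with hG
  set w := fun j => (prefixMatrix Nat.ofBits r G 0).adjugate j r with hw
  -- This cofactor is the determinant with row `r` replaced by a unit vector; it is also the
  -- coefficient of the monomial `r` in the annihilator.
  have hwr : w r ≠ 0 := by
    rw [hw]
    simpa [Matrix.adjugate_apply, prefixMatrix_updateRow] using hra
  have hA : (prefixMatrix Nat.ofBits r (G.map (algebraMap F (MvPolynomial (Fin n) F)))
      (powBits fun i => X (ν i))).det = ∑ j, monomial (expBits ν j) (w j) := by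
    rw [hdet]
    refine Finset.sum_congr rfl fun j _ => ?_
    rw [powBits_X, algebraMap_eq, mul_comm, C_mul_monomial, mul_one]
  refine ⟨r, a, _, ?_, ?_, ?_, rfl⟩
  · rw [hev, hA]
    intro h0
    have := congrArg (coeff (expBits ν r)) h0
    simp only [coeff_sum, coeff_monomial, coeff_zero, (expBits_injective hν).eq_iff,
      Finset.sum_ite_eq', Finset.mem_univ, if_true] at this
    exact hwr this
  · intro i
    rw [hev, hA, degreeOf_le_iff]
    intro e he
    obtain ⟨j, -, hj⟩ := Finset.mem_biUnion.1 (support_sum he)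
    have := support_monomial_subset hj
    rw [Finset.mem_singleton] at this
    rw [this]
    exact (expBits_le hν j i).trans (by omega)
  · rw [hev, Annihilates]
    have hz := det_prefixMatrix_eq_zero Nat.ofBits idxU h ev r a v hv0 hv hvr Nat.ofBits_injective
    rw [← hG] at hz ⊢
    rw [hdet, map_sum, ← hz, det_prefixMatrix]
    refine Finset.sum_congr rfl fun j _ => ?_
    rw [map_mul, map_powBits, AlgHom.commutes]
    simp only [aeval_X, h]

/-! ### Circuits for the matrix entries -/

namespace ProjCircuit.Cost

variable {F Y B : Type*} [Field F] {S : Set ((B → Bool) → MvPolynomial Y F)}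

theorem gridPoint {m L : ℕ} (γ : Fin L → F) (u : Fin m × Fin L → B) (j : Fin m) :
    Cost S (L * 13) {fun a => C (gridPoint γ (a ∘ u) j)} := by
  have := sum (S := S) fun i => (bit (u (j, i))).ite (const (γ i)) zero
  refine this.mono subset_rfl (by simp) ?_
  rw [Set.singleton_subset_iff, Set.mem_singleton_iff]
  funext a
  rw [_root_.gridPoint, map_sum]
  exact Finset.sum_congr rfl fun i _ => by cases h : a (u (j, i)) <;> simp [h]

theorem eval_encoded [DecidableEq B] {m k L : ℕ} (K : ProjCircuit F (Fin m ⊕ Fin k))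
    (γ : Fin L → F) (u : Fin m × Fin L → B) (t : K.leafVars × Bool → B)
    (ht : Function.Injective t) (hut : ∀ q w, u q ≠ t w) (p : MvPolynomial (Fin m) F)
    (α : Fin k → F) (hp : aeval (Sum.elim X fun j => (C (α j) : MvPolynomial (Fin m) F)) K.poly = p) :
    Cost (Y := Y) ∅ ((K.size + 1) * (L * 13 + 15) + K.size)
      {fun a => C (eval (_root_.gridPoint γ (a ∘ u)) p)} := by
  have hupd : ∀ (a : B → Bool) w b, Function.update a (t w) b ∘ u = a ∘ u := fun a w b =>
    _root_.funext fun q => Function.update_of_ne (hut q w) _ _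
  have := subst K (fun w => t (w, false)) (fun w => t (w, true))
    (fun w w' h => congrArg Prod.fst (ht h)) (fun w w' h => congrArg Prod.fst (ht h))
    (fun w w' h => by simpa using ht h)
    (Sum.elim (fun j a => (C (_root_.gridPoint γ (a ∘ u) j) : MvPolynomial Y F))
      fun j _ => C (α j)) (L := L * 13)
    (by
      rintro (j | j)
      · exact gridPoint γ u j
      · exact (const (α j)).mono_cost (Nat.zero_le _))
    (by rintro (j | j) a w b <;> simp [hupd])
    (by rintro (j | j) a w b <;> simp [hupd])
  refine this.mono subset_rfl le_rfl ?_
  rw [Set.singleton_subset_iff, Set.mem_singleton_iff]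
  funext a
  rw [← hp]
  have hc : (aeval fun y => Sum.elim (fun j a => (C (_root_.gridPoint γ (a ∘ u) j) : MvPolynomial Y F))
      (fun j _ => C (α j)) y a) = ((Algebra.ofId F (MvPolynomial Y F)).comp
      (aeval (_root_.gridPoint γ (a ∘ u)))).comp
        (aeval (Sum.elim X fun j => (C (α j) : MvPolynomial (Fin m) F))) := by
    ext y : 1
    rcases y with j | j <;> simp [Algebra.ofId_apply, algebraMap_eq]
  rw [hc]
  rfl

/-- The sum runs over all 2 ^ (mL) grid points, but costs only a constant per bit of the point
register. -/
theorem gram [DecidableEq B] {N β m L n : ℕ} (γ : Fin L → F) (G : Fin N → MvPolynomial (Fin m) F)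
    {u : Fin m × Fin L → B} (hu : Function.Injective u) {c₀ c₁ : Fin (N * β) → B}
    (hc₀ : ∀ q q', u q ≠ c₀ q') (hc₁ : ∀ q q', u q ≠ c₁ q')
    (hG : ∀ i, Cost S n {fun a => C (eval (_root_.gridPoint γ (a ∘ u)) (G i))}) (x : F) :
    Cost S (17 * (m * L) + 2 * (N * β * (n + 2 * β + 13)) + 4)
      {fun a => C (_root_.gram (fun u => Nat.ofBits (u ∘ finProdFinEquiv.symm)) (fun u c =>
        _root_.powBits (fun i => eval (_root_.gridPoint γ u) (G i)) c) x (a ∘ c₀) (a ∘ c₁))} := by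
  have h1 := const_pow_ofBits (S := S) x (u ∘ finProdFinEquiv.symm)
  have h2 := (h1.mul ((powBits hG c₀).mul (powBits hG c₁))).sum_bits u hu
  refine h2.mono subset_rfl (by simp; nlinarith) ?_
  rw [Set.singleton_subset_iff, Set.mem_singleton_iff]
  funext a
  rw [_root_.gram, Matrix.of_apply, map_sum]
  refine Finset.sum_congr rfl fun y _ => ?_
  have e1 : Function.extend u y a ∘ u = y := _root_.funext fun q => hu.extend_apply _ _ _
  have e2 : ∀ c : Fin (N * β) → B, (∀ q q', u q ≠ c q') → Function.extend u y a ∘ c = a ∘ c :=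
    fun c hc => _root_.funext fun q => Function.extend_apply' _ _ _ fun ⟨q', h⟩ => hc q' q h
  rw [← Function.comp_assoc, e1, e2 c₀ hc₀, e2 c₁ hc₁, map_mul, map_mul, map_powBits, map_powBits]

theorem prefixMatrix [DecidableEq B] {N β n : ℕ} (r : Fin (N * β) → Bool) (ν : Fin N → Y)
    (c₀ c₁ : Fin (N * β) → B) {G : Matrix (Fin (N * β) → Bool) (Fin (N * β) → Bool) F}
    (hG : Cost S n {fun a => C (G (a ∘ c₀) (a ∘ c₁))}) :
    Cost S (n + N * β * (17 * (N * β) + 2 * β + 70) + 50)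
      {fun a => _root_.prefixMatrix Nat.ofBits r (G.map (algebraMap F (MvPolynomial Y F)))
        (_root_.powBits fun i => X (ν i)) (a ∘ c₀) (a ∘ c₁)} := by
  have h₀ := fun q => bit (S := S) (c₀ q)
  have h₁ := fun q => bit (S := S) (c₁ q)
  have hr := fun q => const_bool (S := S) (r q)
  have heq : Cost S (N * β * 17) {fun a => if decide (a ∘ c₀ = r) then 1 else 0} := by
    simpa [Function.comp_def] using eq h₀ hr
  have heq' : Cost S (N * β * 17) {fun a => if a ∘ c₀ = a ∘ c₁ then 1 else 0} := by
    simpa [Function.comp_def] using eq h₀ h₁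
  have hlt : Cost S (N * β * (N * β * 17 + 20))
      {fun a => if decide (Nat.ofBits (a ∘ c₀) < Nat.ofBits r) then 1 else 0} := by
    simpa [Function.comp_def] using lt h₀ hr
  have := heq.ite (powBits (fun i => var (ν i)) c₁) (hlt.ite hG heq')
  refine this.mono subset_rfl (by nlinarith) ?_
  rw [Set.singleton_subset_iff, Set.mem_singleton_iff]
  funext a
  simp only [_root_.prefixMatrix, Matrix.of_apply, decide_eq_true_eq, Matrix.map_apply,
    algebraMap_eq]

end ProjCircuit.Cost

/-- The auxiliary variables: three registers for pairs of column indices, a register for a point,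
and two switches for each variable of the encoding circuit. -/
abbrev AuxBits (κ m L : ℕ) (W : Type*) := (Fin 3 × Bool × Fin κ) ⊕ (Fin m × Fin L) ⊕ (W × Bool)

/-! ### Size estimate and main theorem -/

theorem size_bound {m d s β L κ Z : ℕ} (hZ : Z = m * d * s) (hm : 3 ≤ m) (hd : 1 ≤ d) (hs : 1 ≤ s)
    (hβ : β ≤ 3 * m * d) (hL : L ≤ 7 * (m * d) ^ 2) (hκ : κ = 2 * m * β) :
    3 * (17 * (m * L) + 2 * (κ * ((s + 1) * (L * 13 + 15) + s + 2 * β + 13)) + 4 +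
      κ * (17 * κ + 2 * β + 70) + 50) + 200 * (κ + 1) ^ 2 +
      (6 * κ + (m * L + 2 * (s + 1))) ≤ Z ^ 15 := by
  have hmd : m ≤ m * d := Nat.le_mul_of_pos_right _ hd
  have hmdZ : m * d ≤ Z := hZ ▸ Nat.le_mul_of_pos_right _ hs
  have hsZ : s ≤ Z := hZ ▸ Nat.le_mul_of_pos_left _ (Nat.mul_pos (by omega) hd)
  have hmZ : m ≤ Z := hmd.trans hmdZ
  have hZ3 : 3 ≤ Z := hm.trans hmZ
  have hβZ : β ≤ 3 * Z := hβ.trans (by rw [mul_assoc]; omega)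
  have hLZ : L ≤ 7 * Z ^ 2 := hL.trans (Nat.mul_le_mul_left _ (Nat.pow_le_pow_left hmdZ 2))
  have hκZ : κ ≤ 6 * Z ^ 2 := by
    rw [hκ]
    calc 2 * m * β ≤ 2 * Z * (3 * Z) := by gcongr
      _ = _ := by ring
  have p1 : 1 ≤ Z := by omega
  have hp : ∀ i j, i ≤ j → Z ^ i ≤ Z ^ j := fun i j h => Nat.pow_le_pow_right p1 h
  have q0 : 1 ≤ Z ^ 5 := Nat.one_le_pow _ _ p1
  have q1 : Z ≤ Z ^ 5 := by simpa using hp 1 5 (by norm_num)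
  have q2 := hp 2 5 (by norm_num)
  have q3 := hp 3 5 (by norm_num)
  have q4 := hp 4 5 (by norm_num)
  calc _ ≤ 3 * (17 * (Z * (7 * Z ^ 2)) + 2 * (6 * Z ^ 2 * ((Z + 1) * (7 * Z ^ 2 * 13 + 15) + Z +
        2 * (3 * Z) + 13)) + 4 + 6 * Z ^ 2 * (17 * (6 * Z ^ 2) + 2 * (3 * Z) + 70) + 50) +
        200 * (6 * Z ^ 2 + 1) ^ 2 + (6 * (6 * Z ^ 2) + (Z * (7 * Z ^ 2) + 2 * (Z + 1))) := by
        gcongr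
    -- The bound has degree 5 in Z. The constant is rounded up to 3 ^ 10, which Z ^ 10 absorbs
    -- because Z ≥ 3; hence the exponent 15.
    _ ≤ 59049 * Z ^ 5 := by ring_nf; omega
    _ = 3 ^ 10 * Z ^ 5 := by norm_num
    _ ≤ Z ^ 10 * Z ^ 5 := Nat.mul_le_mul_right _ (Nat.pow_le_pow_left hZ3 10)
    _ = Z ^ 15 := by rw [← pow_add]

theorem mainTheorem4 :
    ∃ c m₀ : ℕ, ∀ (F : Type*) [Field F] [Infinite F] (m n d s : ℕ),
      m₀ ≤ m → 2 * m ≤ n → 1 ≤ d → 1 ≤ s →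
      ∀ g : Fin n → MvPolynomial (Fin m) F, (∀ i, (g i).totalDegree ≤ d) →
      ∀ (k : ℕ) (C : ProjCircuit F (Fin m ⊕ Fin k)), C.size ≤ s → C.Encodes g →
      ∃ A : MvPolynomial (Fin n) F,
        A ≠ 0 ∧ (∀ i, A.degreeOf i ≤ 3 * m * d) ∧ Annihilates A g ∧
        ∃ (k' : ℕ) (C' : ProjCircuit F (Fin n ⊕ Fin k')),
          C'.size ≤ (m * d * s) ^ c ∧ C'.Computes A := by
  refine ⟨15, 3, fun F _ _ m n d s hm hn hd hs g hg k K hK henc => ?_⟩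
  classical
  obtain ⟨α, hα⟩ := henc
  -- The largest power of two for which exponents stay at most 3md; maximality gives 3md + 1 < 2 · 2
  -- ^ β for the dimension count.
  let β := Nat.log 2 (3 * m * d + 1)
  have hβ : 3 * m * d + 1 < 2 * 2 ^ β := by
    have := Nat.lt_pow_succ_log_self (b := 2) (by norm_num) (3 * m * d + 1)
    rwa [Nat.pow_succ'] at this
  have hβ' : 2 ^ β ≤ 3 * m * d + 1 := Nat.pow_log_le_self 2 (by omega)
  have hβ'' : β ≤ 3 * m * d := Nat.le_of_lt_succ (Nat.log_lt_self 2 (by omega))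
  -- One more than the degree bound of the monomials in the g_i, as the grid test requires.
  let L := 2 * m * d * (2 ^ β - 1) + 1
  have hL : L ≤ 7 * (m * d) ^ 2 := by
    have h1 : 1 ≤ m * d := Nat.mul_pos (by omega) hd
    calc L ≤ 2 * m * d * (3 * m * d) + 1 :=
          Nat.add_le_add_right (Nat.mul_le_mul_left _ (by omega)) 1
      _ ≤ 7 * (m * d) ^ 2 := by nlinarith
  let γ : Fin L → F := fun i => Infinite.natEmbedding F i.val
  have hγ : Function.Injective γ := (Infinite.natEmbedding F).injective.comp Fin.val_injective
  let ν : Fin (2 * m) → Fin n := Fin.castLE hn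
  let idxU : (Fin m × Fin L → Bool) → ℕ := fun u => Nat.ofBits (u ∘ finProdFinEquiv.symm)
  have hU : Function.Injective idxU :=
    Nat.ofBits_injective.comp finProdFinEquiv.symm.surjective.injective_comp_right
  obtain ⟨r, a, A, hA0, hAdeg, hAann, hA⟩ := exists_annihilator hm hd hβ hβ'
    (Fin.castLE_injective hn) g hg (Nat.lt_succ_self _) hγ idxU hU
  refine ⟨A, hA0, hAdeg, hAann, ?_⟩
  let B := AuxBits (2 * m * β) m L K.leafVars
  let u : Fin m × Fin L → B := fun q => .inr (.inl q)
  let t : K.leafVars × Bool → B := fun w => .inr (.inr w)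
  let e : Fin 3 → Bool × Fin (2 * m * β) → B := fun i q => .inl (i, q)
  have he : Function.Injective (Function.uncurry e) := fun x y h => Sum.inl_injective h
  have h1 : ∀ i, ProjCircuit.Cost (Y := Fin n) ∅ ((s + 1) * (L * 13 + 15) + s)
      {fun a => MvPolynomial.C (eval (gridPoint γ (a ∘ u)) (g (ν i)))} := fun i =>
    (ProjCircuit.Cost.eval_encoded K γ u t (fun x y h => Sum.inr_injective (Sum.inr_injective h))
      (fun q w h => Sum.inl_ne_inr (Sum.inr_injective h)) _ (α (ν i)) (hα (ν i))).mono_cost (by gcongr)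
  have h2 := ProjCircuit.Cost.gram γ (fun i => g (ν i)) (u := u)
    (c₀ := fun q => e 0 (true, q)) (c₁ := fun q => e 1 (true, q))
    (fun x y h => Sum.inl_injective (Sum.inr_injective h)) (fun q w h => by simp [u, e] at h)
    (fun q w h => by simp [u, e] at h) h1 a
  have h3 := (ProjCircuit.Cost.prefixMatrix r ν (fun q => e 0 (true, q)) (fun q => e 1 (true, q))
    h2).det he
  rw [← hA] at h3
  obtain ⟨k', C', hC', hcomp⟩ := h3.exists_computes
  refine ⟨k', C', hC'.trans ?_, hcomp⟩
  have hcard : Fintype.card B ≤ 6 * (2 * m * β) + (m * L + 2 * (s + 1)) := by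
    have := K.card_leafVars_le
    simp only [B, AuxBits, Fintype.card_sum, Fintype.card_prod, Fintype.card_fin,
      Fintype.card_bool, Fintype.card_coe]
    omega
  exact (Nat.add_le_add_left hcard _).trans (size_bound rfl hm hd hs hβ'' hL rfl)
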